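/- **Setting.** Let $T>0$ and let $\mathcal T=(\mathcal T_n)$ be a sequence of finite partitions $0=t_{n,0}<\dots<t_{n,K(n)}=T$ of $[0,T]$ with mesh tending to $0$ (for instance a refining one). Let $\mathcal D[0,T]$ be the set of right continuous functions $[0,T]\to\mathbb R$ with left limits, with the Skorohod metric $d_S(x,y)=\inf_\lambda\max\{\|\lambda-I\|_\infty,\|x-y\circ\lambda\|_\infty\}$, $\lambda$ ranging over the strictly increasing continuous maps of $[0,T]$ onto itself; put $x(0-)=x(0)$. For functions $y,x$ on $[0,T]$ the Itô–Föllmer integral is $$\int_0^t y(s)\,dx(s)=\lim_{n\to\infty}\sum_{k<K(n)}y(t_{n,k})\bigl(x(t_{n,k+1}\wedge t)-x(t_{n,k}\wedge t)\bigr)$$ whenever the limit exists. Let $x_0\in\mathbb R$, $\sigma>0$, and let $C\subset\mathbb R$ be non-empty with $\inf C>-1$ and $\inf_{c\in C}|c|>0$. The class $\mathcal J=\mathcal J^{\sigma,C}_{\mathcal T}(x_0)$ consists of all $$x(t)=x_0e^{\sigma z(t)}\prod_{i=1}^{n(t)}(1+a_i),\qquad t\in[0,T],$$ where $z$ is continuous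 with $z(0)=0$ and $\lim_n\sum_{k<K(n)}\bigl(z(t_{n,k+1}\wedge t)-z(t_{n,k}\wedge t)\bigr)^2=t$ for all $t\in[0,T]$, $n(t)=\#\{i:s_i\le t\}$ for finitely many times $0<s_1<\dots<s_m<T$ (possibly $m=0$), and $a_1,\dots,a_m\in C$. The set $\mathcal J$ carries the topology of $d_S$. **Stopping times.** Let $0=\tau_0\le\tau_1\le\tau_2\le\cdots\le T$ be functions $\tau_i:\mathcal J\to[0,T]$ that are NP-stopping times (if $x,y\in\mathcal J$ agree on $[0,\tau_i(x)]$, then $\tau_i(y)=\tau_i(x)$) and such that for each $x\in\mathcal J$ there is a smallest integer $M(x)$ with $\tau_{M(x)}(x)=T$. Assume that they are jointly strong locally continuous: for every $x\in\mathcal J$ there is an open $U_x\subset\mathcal J$ with $x\in\overline{U_x}$ such that, whenever $U_x\ni x_n\to x$, one has $\tau_i(x_n)\to\tau_i(x)$ and $x_n(\tau_i(x_n))\to x(\tau_i(x))$ for all $i$, and $M(x_n)\to M(x)$. **Portfolio.** Let $\phi_0,\phi_1,\dots:[0,T]\times\mathbb R\to\mathbb R$ be continuously differentiable (up to the boundary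 times $0$ and $T$) and let $V_0\in\mathbb R$. For $x\in\mathcal J$, $t\in[0,T]$ put $$\phi(t,x)=1_{[\tau_0(x),\tau_1(x)]}(t)\,\phi_0(t,x(t-))+\sum_{i=1}^{M(x)-1}1_{(\tau_i(x),\tau_{i+1}(x)]}(t)\,\phi_i(t,x(t-)),$$ $$V(t,x)=V_0+\int_0^t\phi(s,x)\,dx(s),\qquad \psi(t,x)=V(t-,x)-x(t-)\,\phi(t,x),$$ with $V(0-,x)=V(0,x)$, and $\Phi=(\psi,\phi)$, $V_\Phi(t,x)=\psi(t,x)+\phi(t,x)x(t)$. **Theorem.** $\Phi$ is an NP-portfolio, i.e. $\Phi(0,x)$ does not depend on $x\in\mathcal J$, and: 1. $\Phi$ is NP-predictable: $\Phi(t,x)=\Phi(t,x')$ whenever $x,x'\in\mathcal J$ agree on $[0,t)$, and $\Phi(\cdot,x)$ is left continuous with right limits for every $x\in\mathcal J$; 2. $\Phi$ is NP-self-financing (with interest rate $0$): for all $x\in\mathcal J$ and $t\in[0,T]$ the Riemann integral $\int_0^t\psi(s,x)\,ds$ and the Itô–Föllmer integral $\int_0^t\phi(s,x)\,dx(s)$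 exist, and $V_\Phi(t,x)=V_\Phi(0,x)+\int_0^t\phi(s,x)\,dx(s)$; 3. $\Phi$ is locally $V$-continuous: for every $x\in\mathcal J$ there is an open $U\subset\mathcal J$ with $x\in\overline U$ such that $V_\Phi(T,x_n)\to V_\Phi(T,x)$ whenever $U\ni x_n\to x$. -/

import Mathlib

open Set Filter Topology

noncomputable section

namespace NPMarket

/-- The time interval `[0, T]`. For `0 < T`, `⊥` is time `0` and `⊤` is time `T`. -/
abbrev Time (T : ℝ) : Type := Set.Icc (0 : ℝ) T

instance instFactLe {T : ℝ} [h : Fact (0 < T)] : Fact ((0 : ℝ) ≤ T) := ⟨h.out.le⟩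

/-- `D[0,T]`: the real functions on `[0,T]` which are right continuous with left limits. -/
@[ext]
structure RCLL (T : ℝ) where
  toFun : Time T → ℝ
  right_cont : ∀ t, ContinuousWithinAt toFun (Ici t) t
  left_lim : ∀ t, ∃ l, Tendsto toFun (𝓝[<] t) (𝓝 l)

instance instCoeFunRCLL {T : ℝ} : CoeFun (RCLL T) (fun _ => Time T → ℝ) := ⟨RCLL.toFun⟩

/-- The left limit `f(t-)`, with `f(0-) = f(0)`. -/
def leftVal {T : ℝ} (f : Time T → ℝ) (t : Time T) : ℝ := Function.leftLim f t

/-! ### The Skorohod distance -/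

/-- `d_S(x,y) = inf_λ max (‖λ - I‖, ‖x - y ∘ λ‖)`, where `λ` runs over the strictly increasing
continuous maps of `[0,T]` onto itself, which are the order automorphisms of `[0,T]`.
It is finite because RCLL functions are bounded. -/
def skorohodDist {T : ℝ} (x y : RCLL T) : ENNReal :=
  ⨅ l : Time T ≃o Time T, max (⨆ t, edist (l t) t) (⨆ t, edist (x t) (y (l t)))

theorem skorohodDist_self {T : ℝ} (x : RCLL T) : skorohodDist x x = 0 := by
  refine le_antisymm (iInf_le_of_le (OrderIso.refl _) ?_) bot_le
  simp

theorem skorohodDist_le_symm {T : ℝ} (x y : RCLL T) : skorohodDist x y ≤ skorohodDist y x := by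
  refine le_iInf fun l => iInf_le_of_le l.symm (max_le_max ?_ ?_)
  · refine iSup_le fun t => ?_
    have h := le_iSup (fun s => edist (l s) s) (l.symm t)
    simpa [edist_comm] using h
  · refine iSup_le fun t => ?_
    have h := le_iSup (fun s => edist (y s) (x (l s))) (l.symm t)
    simpa [edist_comm] using h

theorem skorohodDist_triangle {T : ℝ} (x y z : RCLL T) :
    skorohodDist x z ≤ skorohodDist x y + skorohodDist y z := by
  refine ENNReal.le_iInf_add_iInf fun l m => iInf_le_of_le (l.trans m) (max_le ?_ ?_)
  · refine iSup_le fun t => (edist_triangle _ (l t) _).trans ?_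
    rw [add_comm]
    exact add_le_add (le_max_of_le_left (le_iSup (fun s => edist (l s) s) t))
      (le_max_of_le_left (le_iSup (fun s => edist (m s) s) (l t)))
  · refine iSup_le fun t => (edist_triangle _ (y (l t)) _).trans ?_
    exact add_le_add (le_max_of_le_right (le_iSup (fun s => edist (x s) (y (l s))) t))
      (le_max_of_le_right (le_iSup (fun s => edist (y s) (z (m s))) (l t)))

/-- The Skorohod metric on `D[0,T]` (and, by restriction, on every class of trajectories). -/
instance instSkorohod {T : ℝ} : PseudoEMetricSpace (RCLL T) where
  edist := skorohodDist
  edist_self := skorohodDist_self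
  edist_comm x y := le_antisymm (skorohodDist_le_symm x y) (skorohodDist_le_symm y x)
  edist_triangle := skorohodDist_triangle

/-! ### Partitions, quadratic variation and integrals -/

/-- A sequence of finite partitions `0 = t_{n,0} < ⋯ < t_{n,K(n)} = T` of `[0,T]` whose mesh tends
to `0`. Nestedness of the partitions is not required. -/
structure PartitionSeq (T : ℝ) [Fact (0 < T)] where
  card : ℕ → ℕ
  pt : ℕ → ℕ → Time T
  first : ∀ n, pt n 0 = ⊥
  last : ∀ n, pt n (card n) = ⊤
  lt_succ : ∀ n, ∀ k < card n, pt n k < pt n (k + 1)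
  mesh : ∀ ε > 0, ∀ᶠ n in atTop, ∀ k < card n, (pt n (k + 1) : ℝ) - pt n k < ε

variable {T : ℝ} [Fact (0 < T)]

/-- `[z]_t = v` along the given sequence of partitions. -/
def HasQuadVar (𝒯 : PartitionSeq T) (z : Time T → ℝ) (t : Time T) (v : ℝ) : Prop :=
  Tendsto (fun n => ∑ k ∈ Finset.range (𝒯.card n),
    (z (min (𝒯.pt n (k + 1)) t) - z (min (𝒯.pt n k) t)) ^ 2) atTop (𝓝 v)

/-- The non-anticipating Riemann sum `∑ y(t_k) (x(t_{k+1} ∧ t) - x(t_k ∧ t))` over the `n`-th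
partition. -/
def follmerSum (𝒯 : PartitionSeq T) (y x : Time T → ℝ) (t : Time T) (n : ℕ) : ℝ :=
  ∑ k ∈ Finset.range (𝒯.card n),
    y (𝒯.pt n k) * (x (min (𝒯.pt n (k + 1)) t) - x (min (𝒯.pt n k) t))

/-- The Itô-Föllmer integral `∫_0^t y(s) dx(s)` exists and equals `I`. -/
def HasFollmerIntegral (𝒯 : PartitionSeq T) (y x : Time T → ℝ) (t : Time T) (I : ℝ) : Prop :=
  Tendsto (follmerSum 𝒯 y x t) atTop (𝓝 I)

/-- The value of the Itô-Föllmer integral (meaningful when the integral exists). -/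
def follmerIntegral (𝒯 : PartitionSeq T) (y x : Time T → ℝ) (t : Time T) : ℝ :=
  limUnder atTop (follmerSum 𝒯 y x t)

/-- The Riemann integral `∫_0^t f(s) ds` exists and equals `I`. -/
def HasRiemannIntegral (f : Time T → ℝ) (t : Time T) (I : ℝ) : Prop :=
  ∀ ε > 0, ∃ δ > 0, ∀ (N : ℕ) (u ξ : ℕ → Time T), u 0 = ⊥ → u N = t →
    (∀ k < N, u k ≤ ξ k ∧ ξ k ≤ u (k + 1) ∧ (u (k + 1) : ℝ) - u k < δ) →
    |∑ k ∈ Finset.range N, f (ξ k) * ((u (k + 1) : ℝ) - u k) - I| < ε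

/-! ### Portfolios -/

/-- The value `V_Φ(t,x) = ψ(t,x) + φ(t,x) x(t)` of `Φ = (ψ, φ)`. -/
def value {J : Set (RCLL T)} (Φ : Time T → J → ℝ × ℝ) (t : Time T) (x : J) : ℝ :=
  (Φ t x).1 + (Φ t x).2 * x.1 t

/-- `Φ : [0,T] × J → ℝ²` is an NP-portfolio. -/
def IsNPPortfolio {J : Set (RCLL T)} (Φ : Time T → J → ℝ × ℝ) : Prop :=
  ∀ x x' : J, Φ ⊥ x = Φ ⊥ x'

def IsNPPredictable {J : Set (RCLL T)} (Φ : Time T → J → ℝ × ℝ) : Prop :=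
  (∀ (t : Time T) (x x' : J), (∀ s < t, x.1 s = x'.1 s) → Φ t x = Φ t x') ∧
  ∀ (x : J) (t : Time T), ContinuousWithinAt (fun s => Φ s x) (Iic t) t ∧
    ∃ l, Tendsto (fun s => Φ s x) (𝓝[>] t) (𝓝 l)

/-- NP-self-financing, for the constant interest rate `r`. -/
def IsNPSelfFinancing (𝒯 : PartitionSeq T) (r : ℝ) {J : Set (RCLL T)}
    (Φ : Time T → J → ℝ × ℝ) : Prop :=
  ∀ (x : J) (t : Time T), ∃ I₁ I₂ : ℝ,
    HasRiemannIntegral (fun s => (Φ s x).1) t I₁ ∧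
    HasFollmerIntegral 𝒯 (fun s => (Φ s x).2) x.1 t I₂ ∧
    value Φ t x = value Φ ⊥ x + r * I₁ + I₂

def LocallyContinuous {X Y : Type*} [TopologicalSpace X] [TopologicalSpace Y] (f : X → Y) : Prop :=
  ∀ x : X, ∃ U : Set X, IsOpen U ∧ x ∈ closure U ∧
    ∀ u : ℕ → X, (∀ n, u n ∈ U) → Tendsto u atTop (𝓝 x) →
      Tendsto (fun n => f (u n)) atTop (𝓝 (f x))

/-- Local V-continuity with respect to the Skorohod metric. -/
def IsLocallyVContinuous {J : Set (RCLL T)} (Φ : Time T → J → ℝ × ℝ) : Prop :=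
  LocallyContinuous (fun x : J => value Φ ⊤ x)

/-! ### Stopping times -/

def IsNPStoppingTime {J : Set (RCLL T)} (τ : J → Time T) : Prop :=
  ∀ x y : J, (∀ s ≤ τ x, x.1 s = y.1 s) → τ y = τ x

/-- A finite (possibly of unbounded length) sequence of stopping times. -/
structure IsFiniteStoppingSeq {J : Set (RCLL T)} (τ : ℕ → J → Time T) : Prop where
  stopping : ∀ i, IsNPStoppingTime (τ i)
  zero : ∀ x, τ 0 x = ⊥
  mono : ∀ x i, τ i x ≤ τ (i + 1) x
  reaches : ∀ x, ∃ i, τ i x = ⊤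

/-- `M(x)`, the smallest `i` with `τ_i(x) = T`. -/
def stopIndex {J : Set (RCLL T)} (τ : ℕ → J → Time T) (x : J) : ℕ := sInf {i | τ i x = ⊤}

/-- Joint strong local continuity with respect to the Skorohod metric. -/
def JointlyStrongLocallyContinuous {J : Set (RCLL T)} (τ : ℕ → J → Time T) : Prop :=
  ∀ x : J, ∃ U : Set J, IsOpen U ∧ x ∈ closure U ∧
    ∀ u : ℕ → J, (∀ n, u n ∈ U) → Tendsto u atTop (𝓝 x) →
      (∀ i, Tendsto (fun n => τ i (u n)) atTop (𝓝 (τ i x))) ∧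
      (∀ i, Tendsto (fun n => (u n).1 (τ i (u n))) atTop (𝓝 (x.1 (τ i x)))) ∧
      Tendsto (fun n => stopIndex τ (u n)) atTop (𝓝 (stopIndex τ x))

/-! ### The jump-diffusion class -/

/-- The continuous functions `z` with `z(0) = 0` and `[z]_t = t` for all `t ∈ [0,T]`. -/
def diffusionPaths (𝒯 : PartitionSeq T) : Set (Time T → ℝ) :=
  {z | Continuous z ∧ z ⊥ = 0 ∧ ∀ t : Time T, HasQuadVar 𝒯 z t t}

/-- `n(t)`, the number of jump times `s_i` with `s_i ≤ t`. -/
def jumpCount {m : ℕ} (s : Fin m → ℝ) (t : ℝ) : ℕ := (Finset.univ.filter fun i => s i ≤ t).card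

/-- The class of all `x(t) = x₀ e^{σ z(t)} ∏_{i=1}^{n(t)} (1 + a_i)` with `[z]_t = t`, finitely many
jump times `0 < s_1 < ⋯ < s_m < T` and `a_i ∈ C` (here `a_i` is `a (i - 1)`). -/
def jumpDiffusion (𝒯 : PartitionSeq T) (x₀ σ : ℝ) (C : Set ℝ) : Set (RCLL T) :=
  {x | ∃ z ∈ diffusionPaths 𝒯, ∃ (m : ℕ) (s : Fin m → ℝ) (a : ℕ → ℝ),
    StrictMono s ∧ (∀ i, 0 < s i ∧ s i < T) ∧ (∀ i < m, a i ∈ C) ∧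
    ∀ t : Time T, x t =
      x₀ * Real.exp (σ * z t) * ∏ i ∈ Finset.range (jumpCount s t), (1 + a i)}

/-! ### Continuously rebalanced portfolios -/

/-- The stock position
`1_{[τ_0, τ_1]}(t) φ_0(t, x(t-)) + ∑_{i=1}^{M(x)-1} 1_{(τ_i, τ_{i+1}]}(t) φ_i(t, x(t-))`. -/
def stockPosition {J : Set (RCLL T)} (τ : ℕ → J → Time T) (φ : ℕ → ℝ → ℝ → ℝ)
    (t : Time T) (x : J) : ℝ :=
  (Icc (τ 0 x) (τ 1 x)).indicator (fun s : Time T => φ 0 s (leftVal x.1 s)) t +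
  ∑ i ∈ Finset.Icc 1 (stopIndex τ x - 1),
    (Ioc (τ i x) (τ (i + 1) x)).indicator (fun s : Time T => φ i s (leftVal x.1 s)) t

/-- `V(t,x) = V₀ + ∫_0^t φ(s,x) dx(s)` for a stock position `φ`. -/
def gain (𝒯 : PartitionSeq T) {J : Set (RCLL T)} (V₀ : ℝ) (φ : Time T → J → ℝ)
    (t : Time T) (x : J) : ℝ :=
  V₀ + follmerIntegral 𝒯 (fun s => φ s x) x.1 t

/-- The portfolio `(ψ, φ)` with initial value `V₀`, given stock position `φ`, and bank position
`ψ(t,x) = V(t-,x) - x(t-) φ(t,x)`. -/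
def financedPortfolio (𝒯 : PartitionSeq T) {J : Set (RCLL T)} (V₀ : ℝ) (φ : Time T → J → ℝ)
    (t : Time T) (x : J) : ℝ × ℝ :=
  (leftVal (fun s => gain 𝒯 V₀ φ s x) t - leftVal x.1 t * φ t x, φ t x)

end NPMarket

end

/-! The integral has a closed form on every path of the class. Between its finitely many jumps, `x`
equals `κ exp(σ z)` with `κ` constant, so its quadratic variation has density `σ² x(s)²`, a function
of the path value alone. For a `C¹` integrand `f` put `F(t,u) = ∫_0^u f(t,v) dv`. A second order
Taylor expansion over the partition cells gives the pathwise Itô formula `∫_0^t f(s,x(s-)) dx(s) =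
F(t,x(t)) - F(0,x(0)) - ∫_0^t (∂_t F + (σ²/2) x² ∂_x f)(s,x(s)) ds - ∑_{s ≤ t} (F(s,x(s)) -
F(s,x(s-)) - f(s,x(s-)) Δx(s))`. The right side, `itoValue`, mentions neither `z` nor the
partitions. The continuous case is `SmoothIntegrand.hasFollmerIntegral_path`;
`JumpPath.hasFollmerIntegral` adds the jumps by induction. Cutting the integrands at the stopping
times turns this into `itoGain`, the integral of the stock position.

Predictability and self-financing: the gain is càdlàg and jumps by `φ Δx` (`itoGain_leftLim`). Hence
`V(t-) - x(t-) φ + x(t) φ = V(t)`, so the portfolio value is the gain itself. Left limits at `t`,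
the events `τ_i < t` and Föllmer sums up to times before `t` use the path before `t` only.

Local continuity: the terminal value is a finite combination of `itoValue` at stopping times. A
Skorohod limit is a pointwise limit off a countable set, so the time integrals converge by dominated
convergence. The jump sums are the delicate part. If `x₀ ≠ 0`, the limit path is bounded away from
`0` and relative jumps are bounded away from `0`, so a nearby path has no small jumps: under the
time changes each of its jumps lies over a jump of the limit (`eventually_jump_of_jump`), and all
sums run over one finite set. If `x₀ = 0`, all paths vanish. A jump of `x` exactly at `τ_i(x)` might
be counted in the limit but missed before it; the convergence `x_n(τ_i(x_n)) → x(τ_i(x))` excludes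
this (`SmoothIntegrand.tendsto_jumpTerm`). -/

noncomputable section

namespace NPMarket

section

variable {T : ℝ}

/-! ### Càdlàg and càglàd functions -/

/-- Left and right limits exist everywhere. -/
def IsRegulated (f : Time T → ℝ) : Prop :=
  ∀ t, (∃ l, Tendsto f (𝓝[<] t) (𝓝 l)) ∧ ∃ l, Tendsto f (𝓝[>] t) (𝓝 l)

/-- Left continuous with right limits. -/
def IsCaglad (f : Time T → ℝ) : Prop :=
  ∀ t, ContinuousWithinAt f (Iic t) t ∧ ∃ l, Tendsto f (𝓝[>] t) (𝓝 l)

/-- Right continuous with left limits. -/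
def IsCadlag (f : Time T → ℝ) : Prop :=
  ∀ t, ContinuousWithinAt f (Ici t) t ∧ ∃ l, Tendsto f (𝓝[<] t) (𝓝 l)

theorem RCLL.isCadlag (x : RCLL T) : IsCadlag x.toFun := fun t => ⟨x.right_cont t, x.left_lim t⟩

theorem IsCaglad.isRegulated {f : Time T → ℝ} (hf : IsCaglad f) : IsRegulated f := fun t =>
  ⟨⟨_, (hf t).1.tendsto.mono_left (nhdsWithin_mono _ Iio_subset_Iic_self)⟩, (hf t).2⟩

theorem IsCadlag.isRegulated {f : Time T → ℝ} (hf : IsCadlag f) : IsRegulated f := fun t =>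
  ⟨(hf t).2, ⟨_, (hf t).1.tendsto.mono_left (nhdsWithin_mono _ Ioi_subset_Ici_self)⟩⟩

theorem isRegulated_of_continuous {g : Time T → ℝ} (hg : Continuous g) : IsRegulated g := fun _ =>
  ⟨⟨_, hg.continuousAt.tendsto.mono_left nhdsWithin_le_nhds⟩,
    ⟨_, hg.continuousAt.tendsto.mono_left nhdsWithin_le_nhds⟩⟩

theorem leftVal_bot [Fact (0 < T)] (f : Time T → ℝ) : leftVal f ⊥ = f ⊥ :=
  leftLim_eq_of_isBot isBot_bot

theorem neBot_nhdsLT [Fact (0 < T)] {t : Time T} (ht : t ≠ ⊥) : (𝓝[<] t).NeBot :=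
  nhdsLT_neBot_of_exists_lt ⟨⊥, bot_lt_iff_ne_bot.2 ht⟩

theorem leftVal_eq_of_tendsto [Fact (0 < T)] {f : Time T → ℝ} {t : Time T} {l : ℝ} (ht : t ≠ ⊥)
    (h : Tendsto f (𝓝[<] t) (𝓝 l)) : leftVal f t = l :=
  haveI := neBot_nhdsLT ht
  leftLim_eq_of_tendsto h

theorem tendsto_leftVal {f : Time T → ℝ} {t : Time T} (h : ∃ l, Tendsto f (𝓝[<] t) (𝓝 l)) :
    Tendsto f (𝓝[<] t) (𝓝 (leftVal f t)) := tendsto_leftLim_of_tendsto h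

theorem leftVal_eq_of_continuousAt {f : Time T → ℝ} {t : Time T} (h : ContinuousAt f t) :
    leftVal f t = f t :=
  ContinuousWithinAt.leftLim_eq h.continuousWithinAt

theorem leftVal_congr [Fact (0 < T)] {f g : Time T → ℝ} {t : Time T} (ht : t ≠ ⊥)
    (hf : ∃ l, Tendsto f (𝓝[<] t) (𝓝 l)) (h : ∀ s < t, f s = g s) : leftVal f t = leftVal g t := by
  obtain ⟨l, hl⟩ := hf
  rw [leftVal_eq_of_tendsto ht hl, leftVal_eq_of_tendsto ht (hl.congr' ?_)]
  filter_upwards [self_mem_nhdsWithin] with s hs using h s hs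

/-- For `c` just to the right of `t`, `leftVal f c` is either a limit of values of `f` near `c` or,
by the default of `Function.leftLim`, the value `f c`; both stay in any closed neighbourhood of `l`
that contains `f` near `c`. -/
theorem tendsto_rightLim_leftVal {f : Time T → ℝ} {t : Time T} {l : ℝ}
    (h : Tendsto f (𝓝[>] t) (𝓝 l)) : Tendsto (leftVal f) (𝓝[>] t) (𝓝 l) := by
  rcases eq_or_neBot (𝓝[>] t) with h' | h'
  · simp [h']
  apply (closed_nhds_basis l).tendsto_right_iff.2
  rintro s ⟨s_mem, s_closed⟩
  have h3 := eventually_eventually_nhdsWithin.2 (h s_mem)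
  filter_upwards [h3, self_mem_nhdsWithin] with c hc hct
  rw [IsOpen.nhdsWithin_eq isOpen_Ioi hct] at hc
  by_cases hl : ∃ y, Tendsto f (𝓝[<] c) (𝓝 y)
  · rcases eq_or_neBot (𝓝[<] c) with h'c | h'c
    · simpa [leftVal, leftLim_eq_of_eq_bot _ h'c] using hc.self_of_nhds
    · exact s_closed.mem_of_tendsto (tendsto_leftVal hl) (hc.filter_mono nhdsWithin_le_nhds)
  · simpa [leftVal, leftLim_eq_of_not_tendsto _ hl] using hc.self_of_nhds

theorem IsCadlag.isCaglad_leftVal {f : Time T → ℝ} (hf : IsCadlag f) : IsCaglad (leftVal f) := fun t =>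
  ⟨continuousWithinAt_leftLim_Iic (tendsto_leftVal (hf t).2),
    ⟨_, tendsto_rightLim_leftVal ((hf t).1.tendsto.mono_left
      (nhdsWithin_mono _ Ioi_subset_Ici_self))⟩⟩

theorem IsCaglad.add {f g : Time T → ℝ} (hf : IsCaglad f) (hg : IsCaglad g) :
    IsCaglad (fun t => f t + g t) := fun t =>
  ⟨(hf t).1.add (hg t).1, let ⟨_, h⟩ := (hf t).2; let ⟨_, h'⟩ := (hg t).2; ⟨_, h.add h'⟩⟩

theorem IsCaglad.sub {f g : Time T → ℝ} (hf : IsCaglad f) (hg : IsCaglad g) :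
    IsCaglad (fun t => f t - g t) := fun t =>
  ⟨(hf t).1.sub (hg t).1, let ⟨_, h⟩ := (hf t).2; let ⟨_, h'⟩ := (hg t).2; ⟨_, h.sub h'⟩⟩

theorem IsCaglad.mul {f g : Time T → ℝ} (hf : IsCaglad f) (hg : IsCaglad g) :
    IsCaglad (fun t => f t * g t) := fun t =>
  ⟨(hf t).1.mul (hg t).1, let ⟨_, h⟩ := (hf t).2; let ⟨_, h'⟩ := (hg t).2; ⟨_, h.mul h'⟩⟩

theorem IsCaglad.sum {ι : Type*} (s : Finset ι) {f : ι → Time T → ℝ} (hf : ∀ i, IsCaglad (f i)) :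
    IsCaglad (fun t => ∑ i ∈ s, f i t) := fun t => by
  refine ⟨tendsto_finsetSum _ fun i _ => (hf i t).1, ?_⟩
  choose l hl using fun i => (hf i t).2
  exact ⟨_, tendsto_finsetSum _ fun i _ => hl i⟩

theorem IsCaglad.comp {f : Time T → ℝ} (hf : IsCaglad f) {g : Time T → ℝ → ℝ}
    (hg : Continuous (Function.uncurry g)) : IsCaglad (fun t => g t (f t)) := fun t => by
  refine ⟨hg.continuousAt.comp_continuousWithinAt (continuousWithinAt_id.prodMk (hf t).1), ?_⟩
  obtain ⟨l, hl⟩ := (hf t).2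
  exact ⟨g t l, (hg.tendsto (t, l)).comp ((tendsto_id.mono_left nhdsWithin_le_nhds).prodMk_nhds hl)⟩

/-- An interval open on the left and closed on the right has a left continuous indicator; the right
limits are those of `f` on `Ico a b` and `0` elsewhere. -/
theorem IsCaglad.indicator_Ioc {f : Time T → ℝ} (hf : IsCaglad f) (a b : Time T) :
    IsCaglad ((Ioc a b).indicator f) := fun t => by
  constructor
  · by_cases h : t ∈ Ioc a b
    · refine (hf t).1.congr_of_eventuallyEq ?_ (indicator_of_mem h f)
      filter_upwards [self_mem_nhdsWithin, nhdsWithin_le_nhds (Ioi_mem_nhds h.1)] with s hs hs'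
      exact indicator_of_mem (s := Ioc a b) ⟨hs', le_trans hs h.2⟩ f
    · refine (continuousWithinAt_const (b := (0 : ℝ))).congr_of_eventuallyEq ?_
        (indicator_of_notMem h f)
      rcases le_or_gt t a with hta | hta
      · filter_upwards [self_mem_nhdsWithin] with s hs
        exact indicator_of_notMem (fun h' => absurd h'.1 (not_lt.2 (le_trans hs hta))) f
      · have hb : b < t := not_le.1 fun h' => h ⟨hta, h'⟩
        filter_upwards [nhdsWithin_le_nhds (Ioi_mem_nhds hb)] with s hs
        exact indicator_of_notMem (fun h' => absurd h'.2 (not_le.2 hs)) f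
  · by_cases h : t ∈ Ico a b
    · obtain ⟨l, hl⟩ := (hf t).2
      refine ⟨l, hl.congr' ?_⟩
      filter_upwards [self_mem_nhdsWithin, nhdsWithin_le_nhds (Iio_mem_nhds h.2)] with s hs hs'
      exact (indicator_of_mem (s := Ioc a b) ⟨lt_of_le_of_lt h.1 hs, le_of_lt hs'⟩ f).symm
    · refine ⟨0, tendsto_const_nhds.congr' ?_⟩
      rcases lt_or_ge t a with hta | hta
      · filter_upwards [nhdsWithin_le_nhds (Iio_mem_nhds hta)] with s hs
        exact (indicator_of_notMem (fun h' => absurd h'.1 (not_lt.2 (le_of_lt hs))) f).symm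
      · have hb : b ≤ t := not_lt.1 fun h' => h ⟨hta, h'⟩
        filter_upwards [self_mem_nhdsWithin] with s hs
        exact (indicator_of_notMem (fun h' => absurd h'.2 (not_le.2 (lt_of_le_of_lt hb hs))) f).symm

theorem IsCaglad.indicator_Icc_bot [Fact (0 < T)] {f : Time T → ℝ} (hf : IsCaglad f) (b : Time T) :
    IsCaglad ((Icc ⊥ b).indicator f) := by
  have h : (Icc ⊥ b).indicator f = fun t => f t - (Ioc b ⊤).indicator f t := by
    funext t
    by_cases h : t ≤ b
    · rw [indicator_of_mem (s := Icc ⊥ b) ⟨bot_le, h⟩, indicator_of_notMem (fun h' => absurd h'.1 (not_lt.2 h)),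
        sub_zero]
    · rw [indicator_of_notMem (fun h' => h h'.2), indicator_of_mem (s := Ioc b ⊤) ⟨not_le.1 h, le_top⟩, sub_self]
  rw [h]
  exact hf.sub (hf.indicator_Ioc _ _)

/-- One-sided limits make `f` bounded near each point, and compactness of `[0,T]` makes this global.
-/
theorem IsRegulated.exists_bound {f : Time T → ℝ} (hf : IsRegulated f) :
    ∃ B, 0 ≤ B ∧ ∀ t, |f t| ≤ B := by
  have key : ∃ B, ∀ t ∈ (univ : Set (Time T)), |f t| ≤ B := by
    refine isCompact_univ.induction_on (p := fun S => ∃ B, ∀ t ∈ S, |f t| ≤ B) ⟨0, by simp⟩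
      (fun s t hst ⟨B, hB⟩ => ⟨B, fun u hu => hB u (hst hu)⟩)
      (fun s t ⟨B, hB⟩ ⟨B', hB'⟩ => ⟨max B B', ?_⟩) (fun t _ => ?_)
    · rintro u (hu | hu)
      · exact (hB u hu).trans (le_max_left _ _)
      · exact (hB' u hu).trans (le_max_right _ _)
    · obtain ⟨⟨l, hl⟩, r, hr⟩ := hf t
      have h1 : ∀ᶠ s in 𝓝[<] t, |f s| < |l| + 1 := hl.abs.eventually_lt_const (by simp)
      have h2 : ∀ᶠ s in 𝓝[>] t, |f s| < |r| + 1 := hr.abs.eventually_lt_const (by simp)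
      have h3 : ∀ᶠ s in 𝓝[≠] t, |f s| ≤ |l| + |r| + |f t| + 1 := by
        rw [← Iio_union_Ioi, nhdsWithin_union, eventually_sup]
        constructor
        · filter_upwards [h1] with s hs
          linarith [abs_nonneg r, abs_nonneg (f t)]
        · filter_upwards [h2] with s hs
          linarith [abs_nonneg l, abs_nonneg (f t)]
      refine ⟨{s | |f s| ≤ |l| + |r| + |f t| + 1}, ?_, _, fun s hs => hs⟩
      rw [nhdsWithin_univ]
      rw [eventually_nhdsWithin_iff] at h3
      filter_upwards [h3] with s hs
      by_cases hst : s = t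
      · subst hst; show |f s| ≤ _; linarith [abs_nonneg l, abs_nonneg r]
      · exact hs hst
  obtain ⟨B, hB⟩ := key
  exact ⟨max B 0, le_max_right _ _, fun t => (hB t trivial).trans (le_max_left _ _)⟩

/-- `A n` collects the points near which `f` is not within `1/(n+1)` of a constant. It has no
accumulation point, because the one-sided limits at `t` serve as constants at all nearby points
other than `t`; so it is finite by compactness, and every discontinuity lies in some `A n`. -/
theorem IsRegulated.countable_not_continuousAt {f : Time T → ℝ} (hf : IsRegulated f) :
    {t | ¬ ContinuousAt f t}.Countable := by
  let A : ℕ → Set (Time T) := fun n =>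
    {t | ¬ ∃ c, ∀ᶠ s in 𝓝 t, |f s - c| < 1 / ((n : ℝ) + 1)}
  have hA : ∀ n, (A n).Finite := by
    intro n
    by_contra hinf
    obtain ⟨t, -, ht⟩ := Set.Infinite.exists_accPt_of_subset_isCompact hinf isCompact_univ
      (subset_univ _)
    rw [accPt_iff_frequently_nhdsNE] at ht
    refine ht ?_
    obtain ⟨⟨l, hl⟩, r, hr⟩ := hf t
    have hpos : (0 : ℝ) < 1 / ((n : ℝ) + 1) := by positivity
    have h1 := eventually_eventually_nhdsWithin.2 (Metric.tendsto_nhds.1 hl _ hpos)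
    have h2 := eventually_eventually_nhdsWithin.2 (Metric.tendsto_nhds.1 hr _ hpos)
    rw [← Iio_union_Ioi, nhdsWithin_union, eventually_sup]
    constructor
    · filter_upwards [h1, self_mem_nhdsWithin] with s hs hst
      rw [IsOpen.nhdsWithin_eq isOpen_Iio hst] at hs
      exact fun h => h ⟨l, hs⟩
    · filter_upwards [h2, self_mem_nhdsWithin] with s hs hst
      rw [IsOpen.nhdsWithin_eq isOpen_Ioi hst] at hs
      exact fun h => h ⟨r, hs⟩
  refine (Set.countable_iUnion fun n => (hA n).countable).mono fun t ht => ?_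
  by_contra hn
  have hn : ∀ n : ℕ, ∃ c, ∀ᶠ s in 𝓝 t, |f s - c| < 1 / ((n : ℝ) + 1) := fun n =>
    not_not.1 fun h => hn (mem_iUnion.2 ⟨n, h⟩)
  refine ht (Metric.tendsto_nhds.2 fun ε hε => ?_)
  obtain ⟨n, hn'⟩ := exists_nat_one_div_lt (half_pos hε)
  obtain ⟨c, hc⟩ := hn n
  filter_upwards [hc] with s hs
  have := hc.self_of_nhds
  rw [Real.dist_eq]
  calc |f s - f t| = |(f s - c) - (f t - c)| := by ring_nf
    _ ≤ |f s - c| + |f t - c| := abs_sub _ _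
    _ < ε := by linarith

theorem IsRegulated.measurable {f : Time T → ℝ} (hf : IsRegulated f) : Measurable f :=
  measurable_of_countable_not_continuousAt hf.countable_not_continuousAt

theorem IsCadlag.comp {f : Time T → ℝ} (hf : IsCadlag f) {g : Time T → ℝ → ℝ}
    (hg : Continuous (Function.uncurry g)) : IsCadlag (fun t => g t (f t)) := fun t => by
  refine ⟨hg.continuousAt.comp_continuousWithinAt (continuousWithinAt_id.prodMk (hf t).1), ?_⟩
  obtain ⟨l, hl⟩ := (hf t).2
  exact ⟨g t l, (hg.tendsto (t, l)).comp ((tendsto_id.mono_left nhdsWithin_le_nhds).prodMk_nhds hl)⟩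

theorem isCadlag_of_continuous {g : Time T → ℝ} (hg : Continuous g) : IsCadlag g := fun _ =>
  ⟨hg.continuousWithinAt, ⟨_, hg.continuousAt.tendsto.mono_left nhdsWithin_le_nhds⟩⟩

end

variable {T : ℝ} [Fact (0 < T)]

/-! ### Time integrals -/

theorem le_of_forall_le_succ {α : Type*} [Preorder α] {u : ℕ → α} {N : ℕ}
    (h : ∀ k < N, u k ≤ u (k + 1)) {i j : ℕ} (hij : i ≤ j) (hj : j ≤ N) : u i ≤ u j := by
  induction j, hij using Nat.le_induction with
  | base => exact le_rfl
  | succ j _ ih => exact (ih (by omega)).trans (h j (by omega))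

theorem exists_lt_le_succ {α : Type*} [LinearOrder α] {u : ℕ → α} {N : ℕ} {s : α}
    (h0 : u 0 < s) (hN : s ≤ u N) : ∃ k < N, u k < s ∧ s ≤ u (k + 1) := by
  induction N with
  | zero => exact absurd h0 (not_lt.2 hN)
  | succ N ih =>
    rcases le_or_gt s (u N) with h | h
    · obtain ⟨k, hk, h'⟩ := ih h
      exact ⟨k, by omega, h'⟩
    · exact ⟨N, by omega, h, hN⟩

/-- The integral `∫_0^t g(s) ds` of a function on `[0,T]`. -/
def timeIntegral (g : Time T → ℝ) (t : Time T) : ℝ :=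
  ∫ s in (0 : ℝ)..t, g (projIcc 0 T (Fact.out (p := 0 < T)).le s)

theorem measurable_comp_projIcc {g : Time T → ℝ} (hg : Measurable g) :
    Measurable fun s : ℝ => g (projIcc 0 T (Fact.out (p := 0 < T)).le s) :=
  hg.comp continuous_projIcc.measurable

theorem intervalIntegrable_comp_projIcc {g : Time T → ℝ} (hg : Measurable g) {B : ℝ}
    (hB : ∀ t, |g t| ≤ B) (a b : ℝ) :
    IntervalIntegrable (fun s : ℝ => g (projIcc 0 T (Fact.out (p := 0 < T)).le s))
      MeasureTheory.volume a b := by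
  refine (intervalIntegrable_const (c := B)).mono_fun
    (measurable_comp_projIcc hg).aestronglyMeasurable (MeasureTheory.ae_of_all _ fun s => ?_)
  exact (hB _).trans (le_abs_self B)

/-- A function of `s ∈ [0,T]` has a Riemann integral if it has left and right limits. -/
theorem IsRegulated.hasRiemannIntegral {f : Time T → ℝ} (hf : IsRegulated f) (t : Time T) :
    HasRiemannIntegral f t (timeIntegral f t) := by
  obtain ⟨B, hB0, hB⟩ := hf.exists_bound
  intro ε hε
  -- Failure yields tagged divisions of mesh below `1/(n+1)` with sums at distance at least `ε`.
  -- These sums are integrals of step functions `g n`, bounded by `B` and converging to `f` at its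
  -- continuity points, hence almost everywhere; dominated convergence gives the contradiction.
  by_contra! hcon
  choose N u ξ h0 hN hu hbad using fun n : ℕ => hcon (1 / ((n : ℝ) + 1)) (by positivity)
  let g : ℕ → ℝ → ℝ := fun n s => ∑ k ∈ Finset.range (N n),
    (Ioc (u n k : ℝ) (u n (k + 1))).indicator (fun _ => f (ξ n k)) s
  have hmono : ∀ n, ∀ k < N n, u n k ≤ u n (k + 1) := fun n k hk =>
    (hu n k hk).1.trans (hu n k hk).2.1
  have hgval : ∀ n, ∀ s : ℝ, 0 < s → s ≤ t → ∃ r : Time T, g n s = f r ∧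
      |(r : ℝ) - s| < 1 / ((n : ℝ) + 1) := by
    intro n s hs0 hst
    obtain ⟨k, hk, hk1, hk2⟩ := exists_lt_le_succ (u := fun k => (u n k : ℝ)) (N := N n) (s := s)
      (by simpa [h0] using hs0) (by simpa [hN] using hst)
    refine ⟨ξ n k, ?_, ?_⟩
    · simp only [g]
      rw [Finset.sum_eq_single_of_mem k (Finset.mem_range.2 hk)]
      · exact indicator_of_mem (s := Ioc (u n k : ℝ) (u n (k + 1))) ⟨hk1, hk2⟩ _
      · intro j hj hjk
        refine indicator_of_notMem (fun hj' => ?_) _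
        rw [Finset.mem_range] at hj
        rcases lt_or_gt_of_ne hjk with h | h
        · have : u n (j + 1) ≤ u n k := le_of_forall_le_succ (hmono n) (by omega) hk.le
          exact absurd (hj'.2.trans this) (not_le.2 hk1)
        · have : u n (k + 1) ≤ u n j := le_of_forall_le_succ (hmono n) (by omega) hj.le
          exact absurd (hk2.trans this) (not_le.2 hj'.1)
    · obtain ⟨h1, h2, h3⟩ := hu n k hk
      have h1 : (u n k : ℝ) ≤ ξ n k := h1
      have h2 : (ξ n k : ℝ) ≤ u n (k + 1) := h2
      rw [abs_lt]
      constructor <;> linarith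
  have hgint : ∀ n, ∫ s in (0 : ℝ)..t, g n s =
      ∑ k ∈ Finset.range (N n), f (ξ n k) * ((u n (k + 1) : ℝ) - u n k) := by
    intro n
    rw [intervalIntegral.integral_of_le t.2.1, MeasureTheory.integral_finsetSum]
    · refine Finset.sum_congr rfl fun k hk => ?_
      rw [Finset.mem_range] at hk
      have h2 : u n (k + 1) ≤ t := by
        rw [← hN n]; exact le_of_forall_le_succ (hmono n) hk le_rfl
      have hsub : Ioc (u n k : ℝ) (u n (k + 1)) ⊆ Ioc (0 : ℝ) t := fun s hs =>
        ⟨lt_of_le_of_lt (u n k).2.1 hs.1, hs.2.trans h2⟩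
      rw [MeasureTheory.setIntegral_indicator measurableSet_Ioc, inter_eq_right.2 hsub]
      simp only [MeasureTheory.setIntegral_const, MeasureTheory.measureReal_def, Real.volume_Ioc]
      rw [ENNReal.toReal_ofReal (sub_nonneg.2 (hmono n k hk)), smul_eq_mul, mul_comm]
    · intro k _
      exact (MeasureTheory.integrable_const _).indicator measurableSet_Ioc
  have hlim : Tendsto (fun n => ∫ s in (0 : ℝ)..t, g n s) atTop (𝓝 (timeIntegral f t)) := by
    refine intervalIntegral.tendsto_integral_filter_of_dominated_convergence (fun _ => B)
      (Eventually.of_forall fun n => ?_) (Eventually.of_forall fun n => ?_)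
      intervalIntegrable_const ?_
    · exact (Finset.measurable_fun_sum _ fun k _ =>
        measurable_const.indicator measurableSet_Ioc).aestronglyMeasurable
    · refine MeasureTheory.ae_of_all _ fun s hs => ?_
      rw [uIoc_of_le t.2.1] at hs
      obtain ⟨r, hr, -⟩ := hgval n s hs.1 hs.2
      rw [hr]
      exact hB r
    · have hnull : MeasureTheory.volume ((fun t : Time T => (t : ℝ)) '' {t | ¬ ContinuousAt f t})
          = 0 := (hf.countable_not_continuousAt.image _).measure_zero _
      have hae : ∀ᵐ s : ℝ, s ∉ (fun t : Time T => (t : ℝ)) '' {t | ¬ ContinuousAt f t} :=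
        MeasureTheory.measure_eq_zero_iff_ae_notMem.1 hnull
      filter_upwards [hae] with s hs hst
      rw [uIoc_of_le t.2.1] at hst
      have hsT : s ∈ Icc (0 : ℝ) T := ⟨hst.1.le, hst.2.trans t.2.2⟩
      rw [projIcc_of_mem _ hsT]
      have hc : ContinuousAt f ⟨s, hsT⟩ := by
        by_contra hc
        exact hs ⟨⟨s, hsT⟩, hc, rfl⟩
      choose r hr hrs using fun n => hgval n s hst.1 hst.2
      simp_rw [hr]
      refine hc.tendsto.comp (tendsto_iff_dist_tendsto_zero.2 ?_)
      exact squeeze_zero (fun _ => dist_nonneg) (fun n => (hrs n).le)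
        tendsto_one_div_add_atTop_nhds_zero_nat
  obtain ⟨n, hn⟩ := (Metric.tendsto_nhds.1 hlim ε hε).exists
  rw [hgint, Real.dist_eq] at hn
  exact absurd hn (not_lt.2 (hbad n))

/-! ### Sums over partitions -/

namespace PartitionSeq

variable (𝒯 : PartitionSeq T)

theorem pt_le {n i j : ℕ} (hij : i ≤ j) (hj : j ≤ 𝒯.card n) : 𝒯.pt n i ≤ 𝒯.pt n j :=
  le_of_forall_le_succ (fun k hk => (𝒯.lt_succ n k hk).le) hij hj

/-- Both conventions for the cell containing `r` occur: `[t_k, t_{k+1})` when right continuity at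
`r` is used, `(t_k, t_{k+1}]` when what happens strictly before `r` matters. -/
theorem eq_of_le_lt {n k k' : ℕ} {r : Time T} (hk : k < 𝒯.card n) (hk' : k' < 𝒯.card n)
    (h : 𝒯.pt n k ≤ r ∧ r < 𝒯.pt n (k + 1)) (h' : 𝒯.pt n k' ≤ r ∧ r < 𝒯.pt n (k' + 1)) :
    k = k' := by
  by_contra hne
  rcases lt_or_gt_of_ne hne with hlt | hlt
  · exact absurd (h.2.trans_le (𝒯.pt_le hlt hk'.le)) (not_lt.2 h'.1)
  · exact absurd (h'.2.trans_le (𝒯.pt_le hlt hk.le)) (not_lt.2 h.1)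

theorem eq_of_lt_le {n k k' : ℕ} {r : Time T} (hk : k < 𝒯.card n) (hk' : k' < 𝒯.card n)
    (h : 𝒯.pt n k < r ∧ r ≤ 𝒯.pt n (k + 1)) (h' : 𝒯.pt n k' < r ∧ r ≤ 𝒯.pt n (k' + 1)) :
    k = k' := by
  by_contra hne
  rcases lt_or_gt_of_ne hne with hlt | hlt
  · exact absurd (h.2.trans (𝒯.pt_le hlt hk'.le)) (not_le.2 h'.1)
  · exact absurd (h'.2.trans (𝒯.pt_le hlt hk.le)) (not_le.2 h.1)

/-- A sum with at most one nonzero term is small if its terms are. -/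
theorem tendsto_sum_zero {A : ℕ → ℕ → ℝ} {P : ℕ → ℕ → Prop}
    (hP : ∀ n, ∀ k < 𝒯.card n, ∀ k' < 𝒯.card n, P n k → P n k' → k = k')
    (h0 : ∀ n, ∀ k < 𝒯.card n, ¬ P n k → A n k = 0)
    (hA : ∀ ε > 0, ∀ᶠ n in atTop, ∀ k < 𝒯.card n, P n k → |A n k| < ε) :
    Tendsto (fun n => ∑ k ∈ Finset.range (𝒯.card n), A n k) atTop (𝓝 0) := by
  refine Metric.tendsto_nhds.2 fun ε hε => ?_
  filter_upwards [hA ε hε] with n hn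
  rw [Real.dist_eq, sub_zero]
  by_cases h : ∃ k < 𝒯.card n, P n k
  · obtain ⟨k, hk, hPk⟩ := h
    rw [Finset.sum_eq_single_of_mem k (Finset.mem_range.2 hk)]
    · exact hn k hk hPk
    · intro j hj hjk
      rw [Finset.mem_range] at hj
      exact h0 n j hj fun hPj => hjk (hP n j hj k hk hPj hPk)
  · push Not at h
    rw [Finset.sum_eq_zero fun k hk => h0 n k (Finset.mem_range.1 hk) (h k (Finset.mem_range.1 hk))]
    simpa using hε

end PartitionSeq

/-! ### Föllmer sums: dependence on the past, and cutting the integrand at fixed times -/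

theorem follmerSum_bot (𝒯 : PartitionSeq T) (y x : Time T → ℝ) (n : ℕ) :
    follmerSum 𝒯 y x ⊥ n = 0 := by
  simp [follmerSum]

/-- The integrand matters only strictly before `t`: if `t_k ≥ t`, both ends of the truncated cell
equal `t` and the increment is `0`. -/
theorem follmerSum_congr {𝒯 : PartitionSeq T} {y y' x x' : Time T → ℝ} {t : Time T}
    (hy : ∀ s < t, y s = y' s) (hx : ∀ s ≤ t, x s = x' s) (n : ℕ) :
    follmerSum 𝒯 y x t n = follmerSum 𝒯 y' x' t n := by
  refine Finset.sum_congr rfl fun k hk => ?_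
  rw [hx _ (min_le_right _ _), hx _ (min_le_right _ _)]
  rcases lt_or_ge (𝒯.pt n k) t with h | h
  · rw [hy _ h]
  · rw [min_eq_right h, min_eq_right (h.trans (𝒯.lt_succ n k (Finset.mem_range.1 hk)).le)]
    simp

/-- The Föllmer sums over `(a, b]` are asymptotically determined by the integrand on `(a, b]`. -/
theorem tendsto_follmerSum_sub_zero (𝒯 : PartitionSeq T) {g x : Time T → ℝ}
    (hx : ∀ t, ContinuousWithinAt x (Ici t) t) {B : ℝ} (hg : ∀ t, |g t| ≤ B) {a b : Time T}
    (hab : a ≤ b) (h : ∀ s ∈ Ioc a b, g s = 0) :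
    Tendsto (fun n => follmerSum 𝒯 g x b n - follmerSum 𝒯 g x a n) atTop (𝓝 0) := by
  simp only [follmerSum, ← Finset.sum_sub_distrib]
  -- Only the cell straddling `a` survives. Its term is `g(t_k) (x(t_{k+1} ∧ b) - x(a))`, which is
  -- small by right continuity of `x` at `a`.
  refine 𝒯.tendsto_sum_zero (P := fun n k => 𝒯.pt n k ≤ a ∧ a < 𝒯.pt n (k + 1))
    (fun n k hk k' hk' => 𝒯.eq_of_le_lt hk hk') (fun n k hk hP => ?_) fun ε hε => ?_
  · have hlt := (𝒯.lt_succ n k hk).le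
    rcases le_or_gt (𝒯.pt n k) a with h1 | h1
    · have h2 : 𝒯.pt n (k + 1) ≤ a := not_lt.1 fun h' => hP ⟨h1, h'⟩
      simp [min_eq_left h1, min_eq_left h2, min_eq_left (h1.trans hab), min_eq_left (h2.trans hab)]
    · rw [min_eq_right h1.le, min_eq_right (h1.le.trans hlt)]
      rcases le_or_gt (𝒯.pt n k) b with h3 | h3
      · simp [h _ ⟨h1, h3⟩]
      · simp [min_eq_right h3.le, min_eq_right (h3.le.trans hlt)]
  · have hB : 0 ≤ B := (abs_nonneg _).trans (hg a)
    obtain ⟨δ, hδ, hδ'⟩ := Metric.continuousWithinAt_iff.1 (hx a) (ε / (B + 1)) (by positivity)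
    filter_upwards [𝒯.mesh δ hδ] with n hn k hk hP
    have h1 : a ≤ min (𝒯.pt n (k + 1)) b := le_min hP.2.le hab
    have h2 : |x (min (𝒯.pt n (k + 1)) b) - x a| < ε / (B + 1) := by
      refine hδ' h1 ?_
      rw [Subtype.dist_eq, Real.dist_eq, abs_of_nonneg (sub_nonneg.2 (Subtype.coe_le_coe.2 h1))]
      have h3 : ((min (𝒯.pt n (k + 1)) b : Time T) : ℝ) ≤ 𝒯.pt n (k + 1) := min_le_left _ _
      have h4 : (𝒯.pt n k : ℝ) ≤ a := hP.1
      linarith [hn k hk]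
    rw [min_eq_left hP.1, min_eq_left (hP.1.trans hab), min_eq_right hP.2.le]
    calc _ = |g (𝒯.pt n k)| * |x (min (𝒯.pt n (k + 1)) b) - x a| := by
          rw [← abs_mul]; ring_nf
      _ ≤ B * |x (min (𝒯.pt n (k + 1)) b) - x a| :=
          mul_le_mul_of_nonneg_right (hg _) (abs_nonneg _)
      _ ≤ B * (ε / (B + 1)) := mul_le_mul_of_nonneg_left h2.le hB
      _ < ε := by
          rw [mul_div_assoc', div_lt_iff₀ (by positivity)]
          nlinarith

theorem tendsto_follmerSum_sub_of_eqOn (𝒯 : PartitionSeq T) {h h' x : Time T → ℝ}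
    (hx : ∀ t, ContinuousWithinAt x (Ici t) t) {B B' : ℝ} (hh : ∀ t, |h t| ≤ B)
    (hh' : ∀ t, |h' t| ≤ B') {a b : Time T} (hab : a ≤ b) (heq : ∀ s ∈ Ioc a b, h s = h' s)
    {L : ℝ} (hL : Tendsto (fun n => follmerSum 𝒯 h' x b n - follmerSum 𝒯 h' x a n) atTop (𝓝 L)) :
    Tendsto (fun n => follmerSum 𝒯 h x b n - follmerSum 𝒯 h x a n) atTop (𝓝 L) := by
  have key := tendsto_follmerSum_sub_zero 𝒯 hx (g := fun t => h t - h' t) (B := B + B')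
    (fun t => (abs_sub _ _).trans (add_le_add (hh t) (hh' t))) hab
    (fun s hs => sub_eq_zero.2 (heq s hs))
  have := key.add hL
  rw [zero_add] at this
  refine this.congr fun n => ?_
  have e : ∀ t, follmerSum 𝒯 (fun t => h t - h' t) x t n =
      follmerSum 𝒯 h x t n - follmerSum 𝒯 h' x t n := fun t => by
    simp only [follmerSum, ← Finset.sum_sub_distrib, sub_mul]
  rw [e, e]
  ring

/-- Up to `min b t` the cut integrand is `h`, from there to `t` it vanishes; the cell straddling
`min b t` is negligible by `tendsto_follmerSum_sub_zero`. -/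
theorem HasFollmerIntegral.indicator_Icc_bot {𝒯 : PartitionSeq T} {h x : Time T → ℝ}
    (hx : ∀ t, ContinuousWithinAt x (Ici t) t) {B : ℝ} (hh : ∀ t, |h t| ≤ B) {I : Time T → ℝ}
    (hI : ∀ t, HasFollmerIntegral 𝒯 h x t (I t)) (b t : Time T) :
    HasFollmerIntegral 𝒯 ((Icc ⊥ b).indicator h) x t (I (min b t)) := by
  have hB : 0 ≤ B := (abs_nonneg _).trans (hh t)
  have hg : ∀ s, |(Icc ⊥ b).indicator h s| ≤ B := fun s => by
    by_cases hs : s ∈ Icc ⊥ b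
    · rw [indicator_of_mem hs]; exact hh s
    · rw [indicator_of_notMem hs]; simpa using hB
  have h1 : Tendsto (fun n => follmerSum 𝒯 ((Icc ⊥ b).indicator h) x t n -
      follmerSum 𝒯 ((Icc ⊥ b).indicator h) x (min b t) n) atTop (𝓝 0) := by
    refine tendsto_follmerSum_sub_zero 𝒯 hx hg (min_le_right _ _) fun s hs => ?_
    refine indicator_of_notMem (fun h' => ?_) _
    exact absurd hs.1 (not_lt.2 (le_min h'.2 hs.2))
  have h2 := tendsto_follmerSum_sub_of_eqOn 𝒯 hx hg hh (bot_le (a := min b t)) (fun s hs =>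
    indicator_of_mem (s := Icc ⊥ b) ⟨bot_le, hs.2.trans (min_le_left _ _)⟩ h)
    (L := I (min b t)) (by simpa [follmerSum_bot, HasFollmerIntegral] using hI (min b t))
  simpa [HasFollmerIntegral, follmerSum_bot] using h1.add h2

theorem HasFollmerIntegral.sub {𝒯 : PartitionSeq T} {h h' x : Time T → ℝ} {t : Time T} {I I' : ℝ}
    (hI : HasFollmerIntegral 𝒯 h x t I) (hI' : HasFollmerIntegral 𝒯 h' x t I') :
    HasFollmerIntegral 𝒯 (fun s => h s - h' s) x t (I - I') := by
  refine (Tendsto.sub hI hI').congr fun n => ?_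
  simp only [follmerSum, ← Finset.sum_sub_distrib, sub_mul]

theorem HasFollmerIntegral.add {𝒯 : PartitionSeq T} {h h' x : Time T → ℝ} {t : Time T} {I I' : ℝ}
    (hI : HasFollmerIntegral 𝒯 h x t I) (hI' : HasFollmerIntegral 𝒯 h' x t I') :
    HasFollmerIntegral 𝒯 (fun s => h s + h' s) x t (I + I') := by
  refine (Tendsto.add hI hI').congr fun n => ?_
  simp only [follmerSum, ← Finset.sum_add_distrib, add_mul]

theorem HasFollmerIntegral.sum {ι : Type*} {𝒯 : PartitionSeq T} (s : Finset ι)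
    {h : ι → Time T → ℝ} {x : Time T → ℝ} {t : Time T} {I : ι → ℝ}
    (hI : ∀ i ∈ s, HasFollmerIntegral 𝒯 (h i) x t (I i)) :
    HasFollmerIntegral 𝒯 (fun u => ∑ i ∈ s, h i u) x t (∑ i ∈ s, I i) := by
  refine (tendsto_finsetSum s hI).congr fun n => ?_
  simp only [follmerSum, Finset.sum_mul]
  exact Finset.sum_comm

theorem HasFollmerIntegral.indicator_Ioc {𝒯 : PartitionSeq T} {h x : Time T → ℝ}
    (hx : ∀ t, ContinuousWithinAt x (Ici t) t) {B : ℝ} (hh : ∀ t, |h t| ≤ B) {I : Time T → ℝ}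
    (hI : ∀ t, HasFollmerIntegral 𝒯 h x t (I t)) {a b : Time T} (hab : a ≤ b) (t : Time T) :
    HasFollmerIntegral 𝒯 ((Ioc a b).indicator h) x t (I (min b t) - I (min a t)) := by
  have h1 := (HasFollmerIntegral.indicator_Icc_bot hx hh hI b t).sub
    (HasFollmerIntegral.indicator_Icc_bot hx hh hI a t)
  convert h1 using 1
  funext s
  by_cases hsa : s ≤ a
  · rw [indicator_of_notMem (fun h' => absurd h'.1 (not_lt.2 hsa)),
      indicator_of_mem (s := Icc ⊥ b) ⟨bot_le, hsa.trans hab⟩,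
      indicator_of_mem (s := Icc ⊥ a) ⟨bot_le, hsa⟩, sub_self]
  · rw [indicator_of_notMem (s := Icc ⊥ a) (fun h' => hsa h'.2), sub_zero]
    simp [indicator, not_le.1 hsa]

/-! ### Weighted sums over partitions -/

/-- If the weights `θ(t_k, t_{k+1})` add up to `r` on every interval `[0, r]` in the limit, the
weighted sums of a continuous function converge to its time integral. -/
theorem tendsto_weightedSum (𝒯 : PartitionSeq T) {θ : Time T → Time T → ℝ} (h0 : ∀ a, θ a a = 0)
    (hpos : ∀ a b, 0 ≤ θ a b) (hsmall : ∀ ε > 0, ∃ δ > 0, ∀ a b, dist a b < δ → θ a b < ε)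
    (hθ : ∀ t : Time T, Tendsto (fun n => ∑ k ∈ Finset.range (𝒯.card n),
      θ (min (𝒯.pt n k) t) (min (𝒯.pt n (k + 1)) t)) atTop (𝓝 (t : ℝ)))
    {g : Time T → ℝ} (hg : Continuous g) (t : Time T) :
    Tendsto (fun n => ∑ k ∈ Finset.range (𝒯.card n),
      g (𝒯.pt n k) * θ (min (𝒯.pt n k) t) (min (𝒯.pt n (k + 1)) t)) atTop
      (𝓝 (timeIntegral g t)) := by
  let w : ℕ → ℕ → ℝ := fun n k => θ (min (𝒯.pt n k) t) (min (𝒯.pt n (k + 1)) t)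
  -- `q n r` is the mass of the cells that start before `r`, always truncated at `t`. It differs
  -- from the sum truncated at `r` only through the cell straddling `r`, so it tends to `r`.
  let q : ℕ → Time T → ℝ := fun n r => ∑ k ∈ Finset.range (𝒯.card n),
    (if 𝒯.pt n k < r then 1 else 0) * w n k
  have hq : ∀ r ≤ t, Tendsto (fun n => q n r) atTop (𝓝 (r : ℝ)) := by
    intro r hr
    have key : Tendsto (fun n => ∑ k ∈ Finset.range (𝒯.card n),
        ((if 𝒯.pt n k < r then 1 else 0) * w n k -
          θ (min (𝒯.pt n k) r) (min (𝒯.pt n (k + 1)) r))) atTop (𝓝 0) := by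
      refine 𝒯.tendsto_sum_zero (P := fun n k => 𝒯.pt n k < r ∧ r ≤ 𝒯.pt n (k + 1))
        (fun n k hk k' hk' => 𝒯.eq_of_lt_le hk hk') (fun n k hk hP => ?_) fun ε hε => ?_
      · rcases lt_or_ge (𝒯.pt n k) r with h1 | h1
        · have h2 : 𝒯.pt n (k + 1) ≤ r := (not_le.1 fun h' => hP ⟨h1, h'⟩).le
          simp [w, h1, min_eq_left h1.le, min_eq_left h2, min_eq_left (h1.le.trans hr),
            min_eq_left (h2.trans hr)]
        · simp [not_lt.2 h1, min_eq_right h1,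
            min_eq_right (h1.trans (𝒯.lt_succ n k hk).le), h0]
      · obtain ⟨δ, hδ, hδ'⟩ := hsmall ε hε
        filter_upwards [𝒯.mesh δ hδ] with n hn k hk hP
        have hs : ∀ u, θ (min (𝒯.pt n k) u) (min (𝒯.pt n (k + 1)) u) < ε := fun u => by
          refine hδ' _ _ (lt_of_le_of_lt ?_ (hn k hk))
          have hlt : (𝒯.pt n k : ℝ) ≤ 𝒯.pt n (k + 1) := (𝒯.lt_succ n k hk).le
          rw [Subtype.dist_eq, Real.dist_eq, abs_sub_comm, ← abs_of_nonneg (sub_nonneg.2 hlt)]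
          have e1 : ∀ p : Time T, ((min p u : Time T) : ℝ) = min (p : ℝ) u := fun p =>
            (Subtype.mono_coe _).map_min
          rw [e1, e1]
          exact (abs_min_sub_min_le_max _ _ _ _).trans (by simp)
        rw [if_pos hP.1, one_mul, abs_lt]
        constructor
        · linarith [hpos (min (𝒯.pt n k) t) (min (𝒯.pt n (k + 1)) t), hs r]
        · linarith [hs t, hpos (min (𝒯.pt n k) r) (min (𝒯.pt n (k + 1)) r)]
    have := key.add (hθ r)
    rw [zero_add] at this
    refine this.congr fun n => ?_
    rw [Finset.sum_sub_distrib, sub_add_cancel]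
  have hwt : ∀ n, ∀ k < 𝒯.card n, ¬ 𝒯.pt n k < t → w n k = 0 := fun n k hk h => by
    have h := not_lt.1 h
    simp [w, min_eq_right h, min_eq_right (h.trans (𝒯.lt_succ n k hk).le), h0]
  refine Metric.tendsto_nhds.2 fun ε' hε' => ?_
  have hT : 0 < T := Fact.out
  -- Three errors are budgeted: the oscillation `ε` of `g` times a total mass below `T + 1`, the
  -- convergence of `q` at the points of a fixed coarse grid, and the error of the coarse Riemann
  -- sum.
  obtain ⟨ε, hε, hεε'⟩ : ∃ ε > 0, ε * (T + 1) + ε + ε < ε' := by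
    refine ⟨ε' / (2 * (T + 3)), by positivity, ?_⟩
    have : ε' / (2 * (T + 3)) * (T + 1) + ε' / (2 * (T + 3)) + ε' / (2 * (T + 3)) = ε' / 2 := by
      field_simp; ring
    rw [this]; linarith
  obtain ⟨δ₁, hδ₁, hu⟩ := Metric.uniformContinuous_iff.1
    (CompactSpace.uniformContinuous_of_continuous hg) ε hε
  obtain ⟨δ₂, hδ₂, hR⟩ := (isRegulated_of_continuous hg).hasRiemannIntegral t ε hε
  obtain ⟨N, hN⟩ := exists_nat_gt (T / min δ₁ δ₂)
  have hN0 : (0 : ℝ) < N := lt_of_le_of_lt (by positivity) hN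
  have hNδ : T / N < min δ₁ δ₂ := by
    rw [div_lt_iff₀ (by positivity)] at hN
    rw [div_lt_iff₀ hN0]; linarith
  let r : ℕ → Time T := fun l => projIcc 0 T hT.le (l / N * t)
  have hr : ∀ l ≤ N, (r l : ℝ) = l / N * t := fun l hl => by
    have hl' : (l : ℝ) / N ≤ 1 := by
      rw [div_le_one hN0]; exact_mod_cast hl
    have : (l : ℝ) / N * t ∈ Icc 0 T :=
      ⟨by have := t.2.1; positivity, by nlinarith [t.2.1, t.2.2]⟩
    simp [r, projIcc_of_mem _ this]
  have hr0 : r 0 = ⊥ := Subtype.ext (by rw [hr 0 (Nat.zero_le _)]; simp)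
  have hrN : r N = t := Subtype.ext (by rw [hr N le_rfl]; field_simp)
  have hrt : ∀ l ≤ N, r l ≤ t := fun l hl => by
    rw [← Subtype.coe_le_coe, hr l hl]
    have hl' : (l : ℝ) / N ≤ 1 := by
      rw [div_le_one hN0]; exact_mod_cast hl
    nlinarith [t.2.1]
  have hrs : ∀ l < N, r l ≤ r (l + 1) ∧ (r (l + 1) : ℝ) - r l < min δ₁ δ₂ := fun l hl => by
    have e : (r (l + 1) : ℝ) - r l = t / N := by
      rw [hr _ hl, hr l hl.le]; push_cast; ring
    have h1 : 0 ≤ (t : ℝ) / N := div_nonneg t.2.1 hN0.le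
    refine ⟨Subtype.coe_le_coe.1 (by linarith), ?_⟩
    rw [e]
    exact lt_of_le_of_lt (div_le_div_of_nonneg_right t.2.2 hN0.le) hNδ
  have hR' := hR N r r hr0 hrN fun l hl =>
    ⟨le_rfl, (hrs l hl).1, (hrs l hl).2.trans_le (min_le_right _ _)⟩
  have hstep : Tendsto (fun n => ∑ l ∈ Finset.range N, g (r l) * (q n (r (l + 1)) - q n (r l)))
      atTop (𝓝 (∑ l ∈ Finset.range N, g (r l) * ((r (l + 1) : ℝ) - r l))) :=
    tendsto_finsetSum _ fun l hl => ((hq _ (hrt _ (Finset.mem_range.1 hl))).sub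
      (hq _ (hrt _ (Finset.mem_range.1 hl).le))).const_mul _
  filter_upwards [Metric.tendsto_nhds.1 hstep ε hε,
    (hq t le_rfl).eventually_lt_const (show (t : ℝ) < T + 1 by linarith [t.2.2])] with n hn hqn
  rw [Real.dist_eq] at hn ⊢
  -- Each `t_k < t` lies in exactly one coarse cell `[r l, r (l+1))`, detected by a difference of
  -- indicators that telescopes to `1`; replacing `g(t_k)` by `g(r l)` costs at most `ε` per unit of
  -- mass.
  have happ : |∑ k ∈ Finset.range (𝒯.card n), g (𝒯.pt n k) * w n k -
      ∑ l ∈ Finset.range N, g (r l) * (q n (r (l + 1)) - q n (r l))| ≤ ε * q n t := by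
    have e1 : ∑ l ∈ Finset.range N, g (r l) * (q n (r (l + 1)) - q n (r l)) =
        ∑ k ∈ Finset.range (𝒯.card n), (∑ l ∈ Finset.range N, g (r l) *
          ((if 𝒯.pt n k < r (l + 1) then 1 else 0) - (if 𝒯.pt n k < r l then 1 else 0))) * w n k := by
      simp only [q, ← Finset.sum_sub_distrib, Finset.mul_sum, Finset.sum_mul]
      rw [Finset.sum_comm]
      refine Finset.sum_congr rfl fun k _ => Finset.sum_congr rfl fun l _ => ?_
      ring
    rw [e1, ← Finset.sum_sub_distrib]
    refine (Finset.abs_sum_le_sum_abs _ _).trans ?_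
    simp only [q, Finset.mul_sum]
    refine Finset.sum_le_sum fun k hk => ?_
    rw [Finset.mem_range] at hk
    by_cases hkt : 𝒯.pt n k < t
    swap
    · simp [hwt n k hk hkt]
    rw [if_pos hkt, one_mul, ← sub_mul, abs_mul, abs_of_nonneg (hpos _ _)]
    refine mul_le_mul_of_nonneg_right ?_ (hpos _ _)
    have htel : ∑ l ∈ Finset.range N, ((if 𝒯.pt n k < r (l + 1) then (1 : ℝ) else 0) -
        (if 𝒯.pt n k < r l then 1 else 0)) = 1 := by
      rw [Finset.sum_range_sub (fun l => if 𝒯.pt n k < r l then (1 : ℝ) else 0), hrN, hr0]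
      simp [hkt]
    calc _ = |∑ l ∈ Finset.range N, (g (𝒯.pt n k) - g (r l)) *
          ((if 𝒯.pt n k < r (l + 1) then 1 else 0) - (if 𝒯.pt n k < r l then 1 else 0))| := by
          simp only [sub_mul (g (𝒯.pt n k)), Finset.sum_sub_distrib (fun l => g (𝒯.pt n k) * _)]
          rw [← Finset.mul_sum, htel, mul_one]
      _ ≤ ∑ l ∈ Finset.range N, ε * ((if 𝒯.pt n k < r (l + 1) then (1 : ℝ) else 0) -
          (if 𝒯.pt n k < r l then 1 else 0)) := by
          refine (Finset.abs_sum_le_sum_abs _ _).trans (Finset.sum_le_sum fun l hl => ?_)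
          obtain ⟨hl1, hl2⟩ := hrs l (Finset.mem_range.1 hl)
          by_cases h1 : 𝒯.pt n k < r l
          · simp [h1, h1.trans_le hl1]
          by_cases h2 : 𝒯.pt n k < r (l + 1)
          swap
          · simp [h1, h2]
          simp only [h1, h2, if_true, if_false, sub_zero, mul_one]
          refine (hu (a := 𝒯.pt n k) (b := r l) ?_).le
          have h1' : (r l : ℝ) ≤ 𝒯.pt n k := not_lt.1 h1
          have h2' : (𝒯.pt n k : ℝ) < r (l + 1) := h2
          rw [Subtype.dist_eq, Real.dist_eq, abs_of_nonneg (by linarith)]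
          linarith [min_le_left δ₁ δ₂]
      _ = ε := by rw [← Finset.mul_sum, htel, mul_one]
  have h3 : ε * q n t ≤ ε * (T + 1) := mul_le_mul_of_nonneg_left hqn.le hε.le
  calc _ ≤ |∑ k ∈ Finset.range (𝒯.card n), g (𝒯.pt n k) * w n k -
        ∑ l ∈ Finset.range N, g (r l) * (q n (r (l + 1)) - q n (r l))| +
        |∑ l ∈ Finset.range N, g (r l) * (q n (r (l + 1)) - q n (r l)) -
          ∑ l ∈ Finset.range N, g (r l) * ((r (l + 1) : ℝ) - r l)| +
        |∑ l ∈ Finset.range N, g (r l) * ((r (l + 1) : ℝ) - r l) - timeIntegral g t| :=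
        (abs_sub_le _ _ _).trans (add_le_add_left (abs_sub_le _ _ _) _)
    _ < ε' := by linarith

/-! ### Itô's formula for a continuous path -/

/-- A continuously differentiable function `f` of `(t, x) ∈ [0,T] × ℝ` with its partial
derivatives. -/
structure SmoothIntegrand (T : ℝ) where
  f : Time T → ℝ → ℝ
  ft : Time T → ℝ → ℝ
  fx : Time T → ℝ → ℝ
  cont_f : Continuous (Function.uncurry f)
  cont_ft : Continuous (Function.uncurry ft)
  cont_fx : Continuous (Function.uncurry fx)
  deriv_x : ∀ s u, HasDerivAt (f s) (fx s u) u
  mean_value : ∀ (u : ℝ) (s s' : Time T), s ≤ s' →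
    ∃ r ∈ Icc s s', f s' u - f s u = ft r u * ((s' : ℝ) - s)

/-- The primitive `∫_0^u h(s,v) dv` in the space variable. -/
def primitive {T : ℝ} (h : Time T → ℝ → ℝ) (s : Time T) (u : ℝ) : ℝ := ∫ v in (0 : ℝ)..u, h s v

section

variable {T : ℝ}

theorem continuous_primitive {h : Time T → ℝ → ℝ} (hh : Continuous (Function.uncurry h)) :
    Continuous (Function.uncurry (primitive h)) := by
  have : Continuous (Function.uncurry fun (p : Time T × ℝ) (v : ℝ) => h p.1 v) :=
    hh.comp ((continuous_fst.comp continuous_fst).prodMk continuous_snd)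
  exact intervalIntegral.continuous_parametric_intervalIntegral_of_continuous this continuous_snd

theorem exists_modulus {h : Time T → ℝ → ℝ} (hh : Continuous (Function.uncurry h)) (R : ℝ) {ε : ℝ}
    (hε : 0 < ε) : ∃ δ > 0, ∀ (s s' : Time T) (u u' : ℝ), |u| ≤ R → |u'| ≤ R → dist s s' < δ →
      |u - u'| < δ → |h s u - h s' u'| < ε := by
  have hK : IsCompact ((univ : Set (Time T)) ×ˢ Icc (-R) R) := isCompact_univ.prod isCompact_Icc
  obtain ⟨δ, hδ, h'⟩ := Metric.uniformContinuousOn_iff.1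
    (hK.uniformContinuousOn_of_continuous hh.continuousOn) ε hε
  refine ⟨δ, hδ, fun s s' u u' hu hu' hs huu => ?_⟩
  exact h' (s, u) ⟨trivial, abs_le.1 hu⟩ (s', u') ⟨trivial, abs_le.1 hu'⟩ (max_lt hs huu)

theorem exists_bound {h : Time T → ℝ → ℝ} (hh : Continuous (Function.uncurry h)) (R : ℝ) :
    ∃ B, 0 ≤ B ∧ ∀ (s : Time T) (u : ℝ), |u| ≤ R → |h s u| ≤ B := by
  have hK : IsCompact ((univ : Set (Time T)) ×ˢ Icc (-R) R) := isCompact_univ.prod isCompact_Icc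
  obtain ⟨B, hB⟩ := hK.exists_bound_of_continuousOn hh.continuousOn
  exact ⟨max B 0, le_max_right _ _, fun s u hu =>
    (hB (s, u) ⟨trivial, abs_le.1 hu⟩).trans (le_max_left _ _)⟩

/-! ### Taylor estimates for the primitive in time and space -/

namespace SmoothIntegrand

variable (f : SmoothIntegrand T)

theorem continuous_slice (s : Time T) : Continuous (f.f s) :=
  f.cont_f.comp (continuous_const.prodMk continuous_id)

theorem continuous_slice_ft (s : Time T) : Continuous (f.ft s) :=
  f.cont_ft.comp (continuous_const.prodMk continuous_id)

/-- The function whose time integral corrects the fundamental theorem of calculus along a path of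
volatility `σ`. -/
def drift (σ : ℝ) (s : Time T) (u : ℝ) : ℝ := primitive f.ft s u + σ ^ 2 / 2 * u ^ 2 * f.fx s u

theorem continuous_drift (σ : ℝ) : Continuous (Function.uncurry (f.drift σ)) :=
  (continuous_primitive f.cont_ft).add
    ((continuous_const.mul (continuous_snd.pow 2)).mul f.cont_fx)

theorem hasDerivAt_primitive (s : Time T) (u : ℝ) :
    HasDerivAt (primitive f.f s) (f.f s u) u :=
  (f.continuous_slice s).integral_hasStrictDerivAt 0 u |>.hasDerivAt

/-- The mean value inequality is applied twice, first to `f` minus its tangent and then to the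
primitive; continuity of `fx` suffices and its modulus is the error constant. -/
theorem space_expansion {R ε δ : ℝ} {s : Time T}
    (hδ : ∀ u u', |u| ≤ R → |u'| ≤ R → |u - u'| < δ → |f.fx s u - f.fx s u'| < ε)
    {u u' : ℝ} (hu : |u| ≤ R) (hu' : |u'| ≤ R) (h : |u' - u| < δ) :
    |primitive f.f s u' - primitive f.f s u - f.f s u * (u' - u) -
      f.fx s u / 2 * (u' - u) ^ 2| ≤ ε * (u' - u) ^ 2 := by
  have hin : ∀ v ∈ uIcc u u', |v| ≤ R ∧ |v - u| ≤ |u' - u| := fun v hv =>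
    ⟨by rcases uIcc_subset_Icc (abs_le.1 hu) (abs_le.1 hu') hv with ⟨h1, h2⟩
        exact abs_le.2 ⟨h1, h2⟩, abs_sub_left_of_mem_uIcc hv⟩
  have h1 : ∀ v ∈ uIcc u u', |f.f s v - f.f s u - f.fx s u * (v - u)| ≤ ε * |u' - u| := by
    intro v hv
    have hsub : uIcc u v ⊆ uIcc u u' := uIcc_subset_uIcc_left hv
    have := (convex_uIcc u v).norm_image_sub_le_of_norm_hasDerivWithin_le
      (f := fun w => f.f s w - f.fx s u * w) (f' := fun w => f.fx s w - f.fx s u) (C := ε)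
      (x := u) (y := v) (fun w _ => by
        refine HasDerivAt.hasDerivWithinAt (((f.deriv_x s w).sub
          ((hasDerivAt_id w).const_mul (f.fx s u))).congr_deriv ?_)
        simp)
      (fun w hw => by
        obtain ⟨hw1, hw2⟩ := hin w (hsub hw)
        exact (hδ w u hw1 hu (lt_of_le_of_lt hw2 h)).le) left_mem_uIcc right_mem_uIcc
    have hε : 0 ≤ ε := (abs_nonneg _).trans (hδ u u hu hu (by
      simpa using lt_of_le_of_lt (abs_nonneg _) h)).le
    calc |f.f s v - f.f s u - f.fx s u * (v - u)|
        = ‖f.f s v - f.fx s u * v - (f.f s u - f.fx s u * u)‖ := by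
          rw [Real.norm_eq_abs]; ring_nf
      _ ≤ ε * |v - u| := this
      _ ≤ ε * |u' - u| := mul_le_mul_of_nonneg_left (hin v hv).2 hε
  have h2 := (convex_uIcc u u').norm_image_sub_le_of_norm_hasDerivWithin_le
      (f := fun w => primitive f.f s w - f.f s u * w - f.fx s u / 2 * (w - u) ^ 2)
      (f' := fun w => f.f s w - f.f s u - f.fx s u * (w - u)) (C := ε * |u' - u|)
      (x := u) (y := u') (fun w _ => by
        have := ((f.hasDerivAt_primitive s w).sub ((hasDerivAt_id w).const_mul (f.f s u))).sub
          ((((hasDerivAt_id w).sub_const u).pow 2).const_mul (f.fx s u / 2))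
        refine HasDerivAt.hasDerivWithinAt (this.congr_deriv ?_)
        simp; ring)
      h1 left_mem_uIcc right_mem_uIcc
  calc _ = ‖primitive f.f s u' - f.f s u * u' - f.fx s u / 2 * (u' - u) ^ 2 -
        (primitive f.f s u - f.f s u * u - f.fx s u / 2 * (u - u) ^ 2)‖ := by
        rw [Real.norm_eq_abs]; ring_nf
    _ ≤ ε * |u' - u| * |u' - u| := h2
    _ = ε * (u' - u) ^ 2 := by rw [mul_assoc, ← sq, sq_abs]

/-- By `mean_value`, the increment in time is `ft` at an intermediate time, for each `v`;
integration over `v` between `0` and `u` produces the factor `R`. -/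
theorem time_expansion {R ε δ : ℝ}
    (hδ : ∀ (s s' : Time T) (u : ℝ), |u| ≤ R → dist s s' < δ → |f.ft s u - f.ft s' u| < ε)
    {s s' : Time T} (hss : s ≤ s') (h : (s' : ℝ) - s < δ) {u : ℝ} (hu : |u| ≤ R) :
    |primitive f.f s' u - primitive f.f s u - primitive f.ft s u * (s' - s)| ≤
      ε * R * ((s' : ℝ) - s) := by
  have hss' : (0 : ℝ) ≤ s' - s := sub_nonneg.2 hss
  have h1 : ∀ v ∈ uIoc 0 u, ‖f.f s' v - f.f s v - f.ft s v * (s' - s)‖ ≤ ε * ((s' : ℝ) - s) := by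
    intro v hv
    have hv' : |v| ≤ R := by
      have := abs_sub_left_of_mem_uIcc (uIoc_subset_uIcc hv)
      simp only [sub_zero] at this
      exact this.trans hu
    obtain ⟨r, hr, hr'⟩ := f.mean_value v s s' hss
    rw [hr', ← sub_mul, Real.norm_eq_abs, abs_mul, abs_of_nonneg hss']
    refine mul_le_mul_of_nonneg_right (hδ r s v hv' ?_).le hss'
    have h2 : (s : ℝ) ≤ r := hr.1
    have h3 : (r : ℝ) ≤ s' := hr.2
    rw [Subtype.dist_eq, Real.dist_eq, abs_of_nonneg (by linarith)]
    linarith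
  have i1 := fun s => (f.continuous_slice s).intervalIntegrable (μ := MeasureTheory.volume) 0 u
  have i2 := ((f.continuous_slice_ft s).mul_const ((s' : ℝ) - s)).intervalIntegrable
    (μ := MeasureTheory.volume) 0 u
  have e : primitive f.f s' u - primitive f.f s u - primitive f.ft s u * (s' - s) =
      ∫ v in (0 : ℝ)..u, (f.f s' v - f.f s v - f.ft s v * (s' - s)) := by
    rw [intervalIntegral.integral_sub ((i1 s').sub (i1 s)) i2,
      intervalIntegral.integral_sub (i1 s') (i1 s), intervalIntegral.integral_mul_const]
    rfl
  rw [e]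
  have hε : 0 ≤ ε := (abs_nonneg _).trans (hδ s s u hu (by
    simpa using lt_of_le_of_lt hss' h)).le
  calc _ ≤ ε * ((s' : ℝ) - s) * |u - 0| := intervalIntegral.norm_integral_le_of_norm_le_const h1
    _ ≤ ε * ((s' : ℝ) - s) * R := by
        rw [sub_zero]; exact mul_le_mul_of_nonneg_left hu (mul_nonneg hε hss')
    _ = _ := by ring

/-- Second order expansion of the primitive, uniformly on compact sets. -/
theorem expansion {R ε : ℝ} (hR : 0 ≤ R) (hε : 0 < ε) : ∃ δ > 0, ∀ (s s' : Time T) (u u' : ℝ),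
    s ≤ s' → (s' : ℝ) - s < δ → |u| ≤ R → |u'| ≤ R → |u' - u| < δ →
    |primitive f.f s' u' - primitive f.f s u - f.f s u * (u' - u) - primitive f.ft s u * (s' - s) -
      f.fx s u / 2 * (u' - u) ^ 2| ≤ ε * (((s' : ℝ) - s) + (u' - u) ^ 2) := by
  -- The time expansion contributes `R` of these units, and moving `primitive f.ft s` from `u'` to
  -- `u` contributes one more.
  have hε₁ : 0 < ε / (R + 1) := by positivity
  obtain ⟨δ₁, hδ₁, h₁⟩ := exists_modulus f.cont_ft R hε₁
  obtain ⟨δ₂, hδ₂, h₂⟩ := exists_modulus f.cont_fx R hε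
  obtain ⟨δ₃, hδ₃, h₃⟩ := exists_modulus (continuous_primitive f.cont_ft) R hε₁
  refine ⟨min δ₁ (min δ₂ δ₃), by positivity, fun s s' u u' hss hs hu hu' h => ?_⟩
  have hs1 := hs.trans_le (min_le_left _ _)
  have h2 := h.trans_le ((min_le_right _ _).trans (min_le_left _ _))
  have h3 := h.trans_le ((min_le_right _ _).trans (min_le_right _ _))
  have hss' : (0 : ℝ) ≤ s' - s := sub_nonneg.2 hss
  have A := f.time_expansion (fun s s' u hu hs => h₁ s s' u u hu hu hs (by simpa using hδ₁))
    hss hs1 hu'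
  have B := f.space_expansion (s := s) (fun u u' hu hu' h => h₂ s s u u' hu hu'
    (by simpa using hδ₂) h) hu hu' h2
  have C : |(primitive f.ft s u' - primitive f.ft s u) * ((s' : ℝ) - s)| ≤
      ε / (R + 1) * ((s' : ℝ) - s) := by
    rw [abs_mul, abs_of_nonneg hss']
    exact mul_le_mul_of_nonneg_right (h₃ s s u' u hu' hu (by simpa using hδ₃) h3).le hss'
  have hsum : ε / (R + 1) * R * ((s' : ℝ) - s) + ε / (R + 1) * ((s' : ℝ) - s) =
      ε * ((s' : ℝ) - s) := by field_simp
  -- The path goes from `(s, u)` to `(s, u')` in space and then to `(s', u')` in time; the middle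
  -- term corrects the point at which the time derivative is taken.
  calc _ = |(primitive f.f s' u' - primitive f.f s u' - primitive f.ft s u' * (s' - s)) +
        ((primitive f.ft s u' - primitive f.ft s u) * (s' - s)) +
        (primitive f.f s u' - primitive f.f s u - f.f s u * (u' - u) -
          f.fx s u / 2 * (u' - u) ^ 2)| := by ring_nf
    _ ≤ _ := abs_add_three _ _ _
    _ ≤ _ := by linarith

end SmoothIntegrand

/-- Factor the difference of squares. For `h = σ Δz` it says that the squared increment of `κ exp(σ
z)` is `σ² w² (Δz)²` up to third order. -/
theorem abs_exp_sub_one_sq_sub_sq_le {h : ℝ} (hh : |h| ≤ 1) :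
    |(Real.exp h - 1) ^ 2 - h ^ 2| ≤ 3 * |h| * h ^ 2 := by
  have h1 := Real.abs_exp_sub_one_sub_id_le hh
  have h2 : |Real.exp h - 1 + h| ≤ 3 * |h| := by
    calc |Real.exp h - 1 + h| = |(Real.exp h - 1 - h) + (h + h)| := by ring_nf
      _ ≤ |Real.exp h - 1 - h| + (|h| + |h|) := (abs_add_le _ _).trans
          (add_le_add_right (abs_add_le _ _) _)
      _ ≤ h ^ 2 + (|h| + |h|) := by linarith
      _ ≤ 3 * |h| := by nlinarith [sq_abs h, abs_nonneg h]
  calc |(Real.exp h - 1) ^ 2 - h ^ 2| = |Real.exp h - 1 - h| * |Real.exp h - 1 + h| := by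
        rw [← abs_mul]; ring_nf
    _ ≤ h ^ 2 * (3 * |h|) := mul_le_mul h1 h2 (abs_nonneg _) (sq_nonneg _)
    _ = _ := by ring

/-- Second order expansion along the path `κ exp(σ z)`. -/
theorem SmoothIntegrand.expansion_path (f : SmoothIntegrand T) {z : Time T → ℝ} (hz : Continuous z)
    (κ σ : ℝ) {w : Time T → ℝ} (hw : ∀ t, w t = κ * Real.exp (σ * z t)) {ε : ℝ} (hε : 0 < ε) :
    ∃ δ > 0, ∀ a b : Time T, a ≤ b → (b : ℝ) - a < δ →
    |primitive f.f b (w b) - primitive f.f a (w a) - f.f a (w a) * (w b - w a) -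
      primitive f.ft a (w a) * (b - a) -
      σ ^ 2 / 2 * (w a) ^ 2 * f.fx a (w a) * (z b - z a) ^ 2| ≤
      ε * (((b : ℝ) - a) + (z b - z a) ^ 2) := by
  have hwc : Continuous w := by
    rw [funext hw]; fun_prop
  obtain ⟨R, hR0, hR⟩ := (isRegulated_of_continuous hwc).exists_bound
  obtain ⟨K, hK0, hK⟩ := exists_bound f.cont_fx R
  -- Since `(Δw)² ≤ 4 R² σ² (Δz)²`, the Taylor error uses at most `ε / 2`; the other half pays for
  -- replacing `(Δw)²` by `σ² w² (Δz)²`.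
  set ε₁ := ε / (1 + 4 * R ^ 2 * σ ^ 2) / 2 with hε₁
  have hε₁pos : 0 < ε₁ := by positivity
  have hε₁le : ε₁ + ε₁ * (4 * R ^ 2 * σ ^ 2) = ε / 2 := by rw [hε₁]; field_simp
  obtain ⟨δ₁, hδ₁, h₁⟩ := f.expansion hR0 hε₁pos
  -- A bound on `|σ Δz|`: below `1` for the exponential estimate, and small enough to absorb the
  -- cubic error `3 K R² σ² |h|`.
  set η := min 1 (ε / (3 * K * R ^ 2 * σ ^ 2 + 1)) with hη
  have hηpos : 0 < η := by positivity
  obtain ⟨δ₂, hδ₂, h₂⟩ := Metric.uniformContinuous_iff.1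
    (CompactSpace.uniformContinuous_of_continuous (hz.const_mul σ)) η hηpos
  obtain ⟨δ₃, hδ₃, h₃⟩ := Metric.uniformContinuous_iff.1
    (CompactSpace.uniformContinuous_of_continuous hwc) δ₁ hδ₁
  refine ⟨min δ₁ (min δ₂ δ₃), by positivity, fun a b hab hd => ?_⟩
  have hab' : (0 : ℝ) ≤ b - a := sub_nonneg.2 hab
  have hdist : dist b a = (b : ℝ) - a := by
    rw [Subtype.dist_eq, Real.dist_eq, abs_of_nonneg hab']
  have hz' := h₂ (hdist.trans_lt (hd.trans_le ((min_le_right _ _).trans (min_le_left _ _))))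
  have hw' := h₃ (hdist.trans_lt (hd.trans_le ((min_le_right _ _).trans (min_le_right _ _))))
  rw [Real.dist_eq] at hz' hw'
  have A := h₁ a b (w a) (w b) hab (hd.trans_le (min_le_left _ _)) (hR a) (hR b) hw'
  set h := σ * z b - σ * z a with hh
  have hh1 : |h| ≤ 1 := hz'.le.trans (min_le_left _ _)
  have hdw : w b - w a = w a * (Real.exp h - 1) := by
    rw [hw b, hw a, hh, Real.exp_sub]
    field_simp
  have hhz : h ^ 2 = σ ^ 2 * (z b - z a) ^ 2 := by rw [hh]; ring
  have E := abs_exp_sub_one_sq_sub_sq_le hh1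
  have hwa2 : (w a) ^ 2 ≤ R ^ 2 := sq_le_sq' (abs_le.1 (hR a)).1 (abs_le.1 (hR a)).2
  have hexp : (Real.exp h - 1) ^ 2 ≤ 4 * h ^ 2 := by
    have := (abs_le.1 E).2
    nlinarith [sq_nonneg h]
  have B : (w b - w a) ^ 2 ≤ 4 * R ^ 2 * σ ^ 2 * (z b - z a) ^ 2 := by
    rw [hdw, mul_pow]
    calc (w a) ^ 2 * (Real.exp h - 1) ^ 2 ≤ R ^ 2 * (4 * h ^ 2) :=
          mul_le_mul hwa2 hexp (sq_nonneg _) (sq_nonneg _)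
      _ = _ := by rw [hhz]; ring
  have C : |f.fx a (w a) / 2 * (w b - w a) ^ 2 -
      σ ^ 2 / 2 * (w a) ^ 2 * f.fx a (w a) * (z b - z a) ^ 2| ≤ ε / 2 * (z b - z a) ^ 2 := by
    have e : f.fx a (w a) / 2 * (w b - w a) ^ 2 -
        σ ^ 2 / 2 * (w a) ^ 2 * f.fx a (w a) * (z b - z a) ^ 2 =
        f.fx a (w a) / 2 * ((w a) ^ 2 * ((Real.exp h - 1) ^ 2 - h ^ 2)) := by
      rw [hdw, hhz]; ring
    rw [e, abs_mul, abs_mul, abs_div, abs_of_nonneg (sq_nonneg (w a)), abs_two]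
    have h4 : |h| * (3 * K * R ^ 2 * σ ^ 2) ≤ ε := by
      have h5 : |h| ≤ ε / (3 * K * R ^ 2 * σ ^ 2 + 1) := hz'.le.trans (min_le_right _ _)
      rw [le_div_iff₀ (by positivity)] at h5
      linarith [abs_nonneg h]
    calc |f.fx a (w a)| / 2 * ((w a) ^ 2 * |(Real.exp h - 1) ^ 2 - h ^ 2|)
        ≤ K / 2 * (R ^ 2 * (3 * |h| * h ^ 2)) := by
          have := hK a (w a) (hR a)
          gcongr
      _ = (|h| * (3 * K * R ^ 2 * σ ^ 2)) / 2 * (z b - z a) ^ 2 := by rw [hhz]; ring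
      _ ≤ ε / 2 * (z b - z a) ^ 2 := by gcongr
  calc _ = |(primitive f.f b (w b) - primitive f.f a (w a) - f.f a (w a) * (w b - w a) -
      primitive f.ft a (w a) * (b - a) - f.fx a (w a) / 2 * (w b - w a) ^ 2) +
      (f.fx a (w a) / 2 * (w b - w a) ^ 2 -
      σ ^ 2 / 2 * (w a) ^ 2 * f.fx a (w a) * (z b - z a) ^ 2)| := by ring_nf
    _ ≤ ε₁ * (((b : ℝ) - a) + (w b - w a) ^ 2) + ε / 2 * (z b - z a) ^ 2 :=
      (abs_add_le _ _).trans (add_le_add A C)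
    _ ≤ ε₁ * (((b : ℝ) - a) + 4 * R ^ 2 * σ ^ 2 * (z b - z a) ^ 2) + ε / 2 * (z b - z a) ^ 2 := by
      gcongr
    _ ≤ _ := by
      have h6 : 0 ≤ ε₁ * (4 * R ^ 2 * σ ^ 2) := by positivity
      nlinarith [sq_nonneg (z b - z a)]

end

theorem timeIntegral_add {g g' : Time T → ℝ} (hg : Continuous g) (hg' : Continuous g')
    (t : Time T) : timeIntegral (fun s => g s + g' s) t = timeIntegral g t + timeIntegral g' t :=
  intervalIntegral.integral_add ((hg.comp continuous_projIcc).intervalIntegrable _ _)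
    ((hg'.comp continuous_projIcc).intervalIntegrable _ _)

/-- Itô's formula along the path `κ exp(σ z)`. -/
theorem SmoothIntegrand.hasFollmerIntegral_path (𝒯 : PartitionSeq T) (f : SmoothIntegrand T)
    {z : Time T → ℝ} (hz : z ∈ diffusionPaths 𝒯) (κ σ : ℝ) {w : Time T → ℝ}
    (hw : ∀ t, w t = κ * Real.exp (σ * z t)) (t : Time T) :
    HasFollmerIntegral 𝒯 (fun s => f.f s (w s)) w t
      (primitive f.f t (w t) - primitive f.f ⊥ (w ⊥) -
        timeIntegral (fun s => f.drift σ s (w s)) t) := by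
  obtain ⟨hzc, -, hqv⟩ := hz
  have hwc : Continuous w := by rw [funext hw]; fun_prop
  have hid : Continuous fun s : Time T => (s, w s) := continuous_id.prodMk hwc
  have hcA : Continuous fun s => primitive f.ft s (w s) := (continuous_primitive f.cont_ft).comp hid
  have hcB : Continuous fun s => σ ^ 2 / 2 * (w s) ^ 2 * f.fx s (w s) :=
    (continuous_const.mul (hwc.pow 2)).mul (f.cont_fx.comp hid)
  have hord : ∀ n, ∀ k < 𝒯.card n, min (𝒯.pt n k) t ≤ min (𝒯.pt n (k + 1)) t := fun n k hk =>
    min_le_min_right _ (𝒯.lt_succ n k hk).le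
  have tel : ∀ (g : Time T → ℝ) (u : Time T) (n : ℕ), ∑ k ∈ Finset.range (𝒯.card n),
      (g (min (𝒯.pt n (k + 1)) u) - g (min (𝒯.pt n k) u)) = g u - g ⊥ := fun g u n => by
    rw [Finset.sum_range_sub (fun k => g (min (𝒯.pt n k) u)), 𝒯.first, 𝒯.last]
    simp
  have lA : Tendsto (fun n => ∑ k ∈ Finset.range (𝒯.card n), primitive f.ft (𝒯.pt n k)
      (w (𝒯.pt n k)) * ((min (𝒯.pt n (k + 1)) t : Time T) - (min (𝒯.pt n k) t : Time T) : ℝ)) atTop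
      (𝓝 (timeIntegral (fun s => primitive f.ft s (w s)) t)) := by
    have := tendsto_weightedSum 𝒯 (θ := fun a b => |(b : ℝ) - a|) (by simp)
      (fun _ _ => abs_nonneg _) (fun ε hε => ⟨ε, hε, fun a b h => by
        rw [dist_comm] at h; exact h⟩) (fun u => ?_) hcA t
    · refine this.congr fun n => Finset.sum_congr rfl fun k hk => ?_
      rw [abs_of_nonneg (sub_nonneg.2 (Subtype.coe_le_coe.2 (hord n k (Finset.mem_range.1 hk))))]
    · refine tendsto_const_nhds.congr fun n => ?_
      have := tel (fun s => (s : ℝ)) u n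
      rw [show ((⊥ : Time T) : ℝ) = 0 from rfl, sub_zero] at this
      rw [← this]
      refine Finset.sum_congr rfl fun k hk => ?_
      rw [abs_of_nonneg (sub_nonneg.2 (Subtype.coe_le_coe.2
        (min_le_min_right _ (𝒯.lt_succ n k (Finset.mem_range.1 hk)).le)))]
  -- The weights here are `(Δz)²`; that they add up to `r` on `[0, r]` is exactly `[z]_r = r`.
  have lB : Tendsto (fun n => ∑ k ∈ Finset.range (𝒯.card n), σ ^ 2 / 2 * (w (𝒯.pt n k)) ^ 2 *
      f.fx (𝒯.pt n k) (w (𝒯.pt n k)) *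
      (z (min (𝒯.pt n (k + 1)) t) - z (min (𝒯.pt n k) t)) ^ 2) atTop
      (𝓝 (timeIntegral (fun s => σ ^ 2 / 2 * (w s) ^ 2 * f.fx s (w s)) t)) := by
    refine tendsto_weightedSum 𝒯 (θ := fun a b => (z b - z a) ^ 2) (by simp)
      (fun _ _ => sq_nonneg _) (fun ε hε => ?_) hqv hcB t
    obtain ⟨δ, hδ, h⟩ := Metric.uniformContinuous_iff.1
      (CompactSpace.uniformContinuous_of_continuous hzc) (Real.sqrt ε) (Real.sqrt_pos.2 hε)
    refine ⟨δ, hδ, fun a b hab => ?_⟩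
    have := h hab
    rw [dist_comm, Real.dist_eq] at this
    rw [← sq_abs]
    exact (Real.lt_sqrt (abs_nonneg _)).1 this
  have hD := lA.add lB
  rw [← timeIntegral_add hcA hcB] at hD
  have key : Tendsto (fun n => (primitive f.f t (w t) - primitive f.f ⊥ (w ⊥)) -
      follmerSum 𝒯 (fun s => f.f s (w s)) w t n -
      (∑ k ∈ Finset.range (𝒯.card n), primitive f.ft (𝒯.pt n k)
      (w (𝒯.pt n k)) * ((min (𝒯.pt n (k + 1)) t : Time T) - (min (𝒯.pt n k) t : Time T) : ℝ) +
      ∑ k ∈ Finset.range (𝒯.card n), σ ^ 2 / 2 * (w (𝒯.pt n k)) ^ 2 *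
      f.fx (𝒯.pt n k) (w (𝒯.pt n k)) *
      (z (min (𝒯.pt n (k + 1)) t) - z (min (𝒯.pt n k) t)) ^ 2)) atTop (𝓝 0) := by
    refine Metric.tendsto_nhds.2 fun ε hε => ?_
    -- The Taylor remainders add up to at most this constant times `t + ∑ (Δz)²`, eventually below
    -- `T + (T + 1)`; one spare unit makes the denominator `2T + 2`.
    have hpos : 0 < ε / (2 * T + 2) := by
      have : 0 < T := Fact.out
      positivity
    obtain ⟨δ, hδ, hexp⟩ := f.expansion_path hzc κ σ hw hpos
    filter_upwards [𝒯.mesh δ hδ,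
      Tendsto.eventually_lt_const (show (t : ℝ) < T + 1 by linarith [t.2.2]) (hqv t)] with n hn hq
    have htel1 := tel (fun s => primitive f.f s (w s)) t n
    have htel2 := tel (fun s => (s : ℝ)) t n
    rw [show ((⊥ : Time T) : ℝ) = 0 from rfl, sub_zero] at htel2
    rw [Real.dist_eq, sub_zero, ← htel1, follmerSum, ← Finset.sum_add_distrib,
      ← Finset.sum_sub_distrib, ← Finset.sum_sub_distrib]
    refine lt_of_le_of_lt ((Finset.abs_sum_le_sum_abs _ _).trans (Finset.sum_le_sum
      (g := fun k => ε / (2 * T + 2) * (((min (𝒯.pt n (k + 1)) t : Time T) : ℝ) -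
        (min (𝒯.pt n k) t : Time T) +
        (z (min (𝒯.pt n (k + 1)) t) - z (min (𝒯.pt n k) t)) ^ 2)) fun k hk => ?_)) ?_
    · rw [Finset.mem_range] at hk
      have hlt := (𝒯.lt_succ n k hk).le
      rcases le_or_gt (𝒯.pt n k) t with h | h
      · have hle := hord n k hk
        have hlt' : ((min (𝒯.pt n (k + 1)) t : Time T) : ℝ) - (min (𝒯.pt n k) t : Time T) < δ := by
          rw [min_eq_left h]
          have : ((min (𝒯.pt n (k + 1)) t : Time T) : ℝ) ≤ 𝒯.pt n (k + 1) := min_le_left _ _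
          linarith [hn k hk]
        have := hexp _ _ hle hlt'
        rw [min_eq_left h] at this ⊢
        refine le_trans (le_of_eq ?_) this
        ring_nf
      · simp [min_eq_right h.le, min_eq_right (h.le.trans hlt)]
    · rw [← Finset.mul_sum, Finset.sum_add_distrib, htel2]
      have hT : 0 < T := Fact.out
      calc _ < ε / (2 * T + 2) * (T + (T + 1)) + ε / (2 * T + 2) := by
            nlinarith [t.2.2]
        _ = ε := by field_simp; ring
  have hfin := (tendsto_const_nhds (x := primitive f.f t (w t) - primitive f.f ⊥ (w ⊥))).sub
    (key.add hD)
  rw [zero_add] at hfin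
  refine hfin.congr fun n => ?_
  ring

/-! ### Paths with finitely many jumps -/

/-- The path which follows `x` before time `s` and `w` from time `s` on. -/
def glue {T : ℝ} (s : Time T) (x w : Time T → ℝ) (t : Time T) : ℝ := if t < s then x t else w t

theorem glue_of_lt {T : ℝ} {s t : Time T} (x w : Time T → ℝ) (h : t < s) : glue s x w t = x t := if_pos h

theorem glue_of_le {T : ℝ} {s t : Time T} (x w : Time T → ℝ) (h : s ≤ t) : glue s x w t = w t :=
  if_neg (not_lt.2 h)

theorem glue_eventuallyEq {T : ℝ} {s t : Time T} (x w : Time T → ℝ) (h : s < t) : glue s x w =ᶠ[𝓝 t] w := by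
  filter_upwards [Ioi_mem_nhds h] with u hu using glue_of_le x w (le_of_lt hu)

theorem IsCadlag.glue {T : ℝ} {s : Time T} {x w : Time T → ℝ} (hx : IsCadlag x) (hw : Continuous w) :
    IsCadlag (glue s x w) := fun t => by
  constructor
  · rcases lt_or_ge t s with h | h
    · refine (hx t).1.congr_of_eventuallyEq ?_ (glue_of_lt x w h)
      filter_upwards [nhdsWithin_le_nhds (Iio_mem_nhds h)] with u hu using glue_of_lt x w hu
    · refine (hw.continuousWithinAt (x := t)).congr (fun u hu => glue_of_le x w (h.trans hu))
        (glue_of_le x w h)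
  · rcases le_or_gt t s with h | h
    · obtain ⟨l, hl⟩ := (hx t).2
      refine ⟨l, hl.congr' ?_⟩
      filter_upwards [self_mem_nhdsWithin] with u hu
      exact (glue_of_lt x w (lt_of_lt_of_le hu h)).symm
    · exact ⟨w t, (hw.continuousAt.tendsto.congr' (glue_eventuallyEq x w h).symm).mono_left
        nhdsWithin_le_nhds⟩

/-- A left limit at `s` itself still sees only `x`. The point `⊥` is separate because `leftVal` is
the value there, whence `⊥ < s`. -/
theorem leftVal_glue_of_le {s t : Time T} {x : Time T → ℝ} (w : Time T → ℝ) (hx : IsCadlag x)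
    (hs : ⊥ < s) (h : t ≤ s) : leftVal (glue s x w) t = leftVal x t := by
  rcases eq_or_ne t ⊥ with rfl | ht
  · rw [leftVal_bot, leftVal_bot, glue_of_lt x w hs]
  · exact (leftVal_congr ht (hx t).2 fun u hu => (glue_of_lt x w (hu.trans_le h)).symm).symm

theorem leftVal_glue_of_lt {T : ℝ} {s t : Time T} (x : Time T → ℝ) {w : Time T → ℝ} (hw : Continuous w)
    (h : s < t) : leftVal (glue s x w) t = w t := by
  rw [leftVal_eq_of_continuousAt, glue_of_le x w h.le]
  exact hw.continuousAt.congr (glue_eventuallyEq x w h).symm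

/-- `JumpPath y C r c x`: the path `x` is obtained from the continuous path `y` by finitely many
relative jumps of sizes in `C`; the last jump is at time `r`, and `x = c y` from then on. -/
inductive JumpPath (y : Time T → ℝ) (C : Set ℝ) : Time T → ℝ → (Time T → ℝ) → Prop
  | start : JumpPath y C ⊥ 1 y
  | jump {r : Time T} {c : ℝ} {x : Time T → ℝ} (s : Time T) (a : ℝ) : JumpPath y C r c x → r < s →
      a ∈ C → JumpPath y C s (c * (1 + a)) (glue s x fun t => c * (1 + a) * y t)

theorem jumpCount_castSucc {m : ℕ} {s : Fin (m + 1) → ℝ} (hs : StrictMono s) (t : ℝ) :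
    jumpCount s t = if t < s (Fin.last m) then jumpCount (s ∘ Fin.castSucc) t else m + 1 := by
  split_ifs with h
  · rw [jumpCount, jumpCount, Finset.card_filter, Finset.card_filter, Fin.sum_univ_castSucc,
      if_neg (not_le.2 h), add_zero]
    rfl
  · have : ∀ i, s i ≤ t := fun i => (hs.monotone (Fin.le_last i)).trans (not_lt.1 h)
    simp [jumpCount, this]

/-- Induction on the number of jumps, splitting off the last one. The clause locating `r` is what
lets the induction see that the next jump comes strictly later. -/
theorem exists_jumpPath (y : Time T → ℝ) (C : Set ℝ) (a : ℕ → ℝ) : ∀ (m : ℕ) (s : Fin m → ℝ),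
    StrictMono s → (∀ i, 0 < s i ∧ s i < T) → (∀ i < m, a i ∈ C) →
    ∃ r : Time T, (r = ⊥ ∨ ∃ i, (r : ℝ) = s i) ∧
      JumpPath y C r (∏ i ∈ Finset.range m, (1 + a i))
        fun t => y t * ∏ i ∈ Finset.range (jumpCount s t), (1 + a i)
  | 0, s, _, _, _ => ⟨⊥, Or.inl rfl, by simpa [jumpCount] using JumpPath.start⟩
  | m + 1, s, hs, hsT, ha => by
    obtain ⟨r, hr, hx⟩ := exists_jumpPath y C a m (s ∘ Fin.castSucc)
      (hs.comp (Fin.strictMono_castSucc)) (fun i => hsT _) (fun i hi => ha i (by omega))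
    refine ⟨⟨s (Fin.last m), (hsT _).1.le, (hsT _).2.le⟩, Or.inr ⟨_, rfl⟩, ?_⟩
    have hrs : r < (⟨s (Fin.last m), (hsT _).1.le, (hsT _).2.le⟩ : Time T) := by
      rw [← Subtype.coe_lt_coe]
      rcases hr with rfl | ⟨i, hi⟩
      · exact (hsT _).1
      · rw [hi]; exact hs (Fin.castSucc_lt_last i)
    have := JumpPath.jump _ (a m) hx hrs (ha m (by omega))
    rw [Finset.prod_range_succ]
    convert this using 1
    funext t
    rw [glue, jumpCount_castSucc hs]
    by_cases h : (t : ℝ) < s (Fin.last m)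
    · rw [if_pos h, if_pos (show t < (⟨s (Fin.last m), (hsT _).1.le, (hsT _).2.le⟩ : Time T) from h)]
    · rw [if_neg h, if_neg (show ¬ t < (⟨s (Fin.last m), (hsT _).1.le, (hsT _).2.le⟩ : Time T)
        from h), Finset.prod_range_succ, mul_comm]

theorem exists_jumpPath_of_mem {𝒯 : PartitionSeq T} {x₀ σ : ℝ} {C : Set ℝ} {x : RCLL T}
    (hx : x ∈ jumpDiffusion 𝒯 x₀ σ C) : ∃ z ∈ diffusionPaths 𝒯, ∃ r c,
      JumpPath (fun t => x₀ * Real.exp (σ * z t)) C r c x.toFun := by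
  obtain ⟨z, hz, m, s, a, hs, hsT, ha, hxt⟩ := hx
  obtain ⟨r, -, h⟩ := exists_jumpPath (fun t => x₀ * Real.exp (σ * z t)) C a m s hs hsT ha
  exact ⟨z, hz, r, _, (funext hxt : x.toFun = _) ▸ h⟩

namespace JumpPath

variable {y : Time T → ℝ} {C : Set ℝ} {r : Time T} {c : ℝ} {x : Time T → ℝ}

theorem isCadlag (h : JumpPath y C r c x) (hy : Continuous y) : IsCadlag x := by
  induction h with
  | start => exact isCadlag_of_continuous hy
  | jump s a _ _ _ ih => exact ih.glue (by fun_prop)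

theorem eq_of_le (h : JumpPath y C r c x) {t : Time T} (ht : r ≤ t) : x t = c * y t := by
  induction h with
  | start => simp
  | jump s a _ _ _ _ => exact glue_of_le _ _ ht

theorem continuousAt_of_lt (h : JumpPath y C r c x) (hy : Continuous y) {t : Time T} (ht : r < t) :
    ContinuousAt x t := by
  refine ((hy.const_mul c).continuousAt (x := t)).congr ?_
  filter_upwards [Ioi_mem_nhds ht] with s hs using (h.eq_of_le (le_of_lt hs)).symm

theorem exists_finset (h : JumpPath y C r c x) (hy : Continuous y) :
    ∃ E : Finset (Time T), ∀ t, leftVal x t ≠ x t → t ∈ E := by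
  induction h with
  | start => exact ⟨∅, fun t ht => absurd (leftVal_eq_of_continuousAt hy.continuousAt) ht⟩
  | @jump r c x s a hx hrs _ ih =>
    obtain ⟨E, hE⟩ := ih
    classical
    refine ⟨insert s E, fun t ht => ?_⟩
    rcases lt_trichotomy t s with h | h | h
    · rw [leftVal_glue_of_le _ (hx.isCadlag hy) (bot_le.trans_lt hrs) h.le, glue_of_lt _ _ h] at ht
      exact Finset.mem_insert_of_mem (hE t ht)
    · simp [h]
    · exact absurd (by rw [leftVal_glue_of_lt _ (by fun_prop) h, glue_of_le _ _ h.le]) ht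

/-- The relative jump sizes belong to `C`. -/
theorem exists_jump_size (h : JumpPath y C r c x) (hy : Continuous y) {t : Time T}
    (ht : leftVal x t ≠ x t) : ∃ a ∈ C, x t - leftVal x t = a * leftVal x t := by
  induction h with
  | start => exact absurd (leftVal_eq_of_continuousAt hy.continuousAt) ht
  | @jump r c x s a hx hrs ha ih =>
    rcases lt_trichotomy t s with h | h | h
    · rw [leftVal_glue_of_le _ (hx.isCadlag hy) (bot_le.trans_lt hrs) h.le, glue_of_lt _ _ h] at ht ⊢
      exact ih ht
    · subst h
      refine ⟨a, ha, ?_⟩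
      rw [leftVal_glue_of_le _ (hx.isCadlag hy) (bot_le.trans_lt hrs) le_rfl, glue_of_le _ _ le_rfl,
        leftVal_eq_of_continuousAt (hx.continuousAt_of_lt hy hrs), hx.eq_of_le hrs.le]
      ring
    · exact absurd (by rw [leftVal_glue_of_lt _ (by fun_prop) h, glue_of_le _ _ h.le]) ht

theorem exists_pos_le_abs (h : JumpPath y C r c x) {m : ℝ} (hm : 0 < m) (hy : ∀ t, m ≤ |y t|)
    (hC : ∀ a ∈ C, 1 + a ≠ 0) : c ≠ 0 ∧ ∃ m' > 0, ∀ t, m' ≤ |x t| := by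
  induction h with
  | start => exact ⟨one_ne_zero, m, hm, hy⟩
  | @jump r c x s a hx hrs ha ih =>
    obtain ⟨hc, m', hm', hx'⟩ := ih
    have hc' : c * (1 + a) ≠ 0 := mul_ne_zero hc (hC a ha)
    have hpos : 0 < |c * (1 + a)| := abs_pos.2 hc'
    refine ⟨hc', min m' (|c * (1 + a)| * m), by positivity, fun t => ?_⟩
    rcases lt_or_ge t s with h | h
    · rw [glue_of_lt _ _ h]
      exact (min_le_left _ _).trans (hx' t)
    · rw [glue_of_le _ _ h, abs_mul _ (y t)]
      exact (min_le_right _ _).trans (mul_le_mul_of_nonneg_left (hy t) hpos.le)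

theorem apply_bot (h : JumpPath y C r c x) : x ⊥ = y ⊥ := by
  induction h with
  | start => rfl
  | jump s a _ hrs _ ih => rw [glue_of_lt _ _ (bot_le.trans_lt hrs), ih]

end JumpPath

/-! ### Itô's formula for paths with jumps -/

/-- The correction of Itô's formula for a jump from `u` to `v` at time `s`. -/
def SmoothIntegrand.jumpTerm {T : ℝ} (f : SmoothIntegrand T) (s : Time T) (u v : ℝ) : ℝ :=
  primitive f.f s v - primitive f.f s u - f.f s u * (v - u)

/-- The value of `∫_0^t f(s, x(s-)) dx(s)` given by Itô's formula. -/
def SmoothIntegrand.itoValue (f : SmoothIntegrand T) (σ : ℝ) (x : Time T → ℝ) (t : Time T) : ℝ :=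
  primitive f.f t (x t) - primitive f.f ⊥ (x ⊥) - timeIntegral (fun s => f.drift σ s (x s)) t -
    ∑ᶠ s, if s ≤ t then f.jumpTerm s (leftVal x s) (x s) else 0

theorem SmoothIntegrand.jumpTerm_self {T : ℝ} (f : SmoothIntegrand T) (s : Time T) (u : ℝ) :
    f.jumpTerm s u u = 0 := by simp [jumpTerm]

/-- The jump term vanishes where `x` has no jump, so any finite set containing the jumps will do.
This freedom is used to compare paths with different jump times. -/
theorem SmoothIntegrand.finsum_jumpTerm {T : ℝ} (f : SmoothIntegrand T) {x : Time T → ℝ}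
    {E : Finset (Time T)} (hE : ∀ t, leftVal x t ≠ x t → t ∈ E) (t : Time T) :
    (∑ᶠ s, if s ≤ t then f.jumpTerm s (leftVal x s) (x s) else 0) =
      ∑ s ∈ E, if s ≤ t then f.jumpTerm s (leftVal x s) (x s) else 0 := by
  refine finsum_eq_sum_of_support_subset _ fun s hs => hE s fun h => hs ?_
  simp [h, f.jumpTerm_self]

/-- The endpoint is a null set; agreement before `t` is all that a path and its continuation by a
jump at `t` share. -/
theorem timeIntegral_congr {g g' : Time T → ℝ} {t : Time T} (h : ∀ s < t, g s = g' s) :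
    timeIntegral g t = timeIntegral g' t := by
  refine intervalIntegral.integral_congr_ae ?_
  have hne : ∀ᵐ s : ℝ, s ≠ t := MeasureTheory.Measure.ae_ne MeasureTheory.volume (t : ℝ)
  filter_upwards [hne] with s hs hst
  rw [uIoc_of_le t.2.1] at hst
  have hsT : s ∈ Icc (0 : ℝ) T := ⟨hst.1.le, hst.2.trans t.2.2⟩
  rw [projIcc_of_mem _ hsT]
  exact h _ (lt_of_le_of_ne (show (⟨s, hsT⟩ : Time T) ≤ t from hst.2)
    fun h' => hs (congrArg Subtype.val h'))

theorem timeIntegral_sub {g : Time T → ℝ} (hg : IsRegulated g) (s t : Time T) :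
    timeIntegral g t - timeIntegral g s =
      ∫ u in (s : ℝ)..t, g (projIcc 0 T (Fact.out (p := 0 < T)).le u) := by
  obtain ⟨B, -, hB⟩ := hg.exists_bound
  exact intervalIntegral.integral_interval_sub_left
    (intervalIntegrable_comp_projIcc hg.measurable hB _ _)
    (intervalIntegrable_comp_projIcc hg.measurable hB _ _)

theorem timeIntegral_sub_congr {g g' : Time T → ℝ} (hg : IsRegulated g) (hg' : IsRegulated g')
    {s t : Time T} (hst : s ≤ t) (h : ∀ u, s ≤ u → g u = g' u) :
    timeIntegral g t - timeIntegral g s = timeIntegral g' t - timeIntegral g' s := by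
  rw [timeIntegral_sub hg, timeIntegral_sub hg']
  refine intervalIntegral.integral_congr fun u hu => ?_
  rw [uIcc_of_le (Subtype.coe_le_coe.2 hst)] at hu
  have huT : u ∈ Icc (0 : ℝ) T := ⟨s.2.1.trans hu.1, hu.2.trans t.2.2⟩
  simp only [projIcc_of_mem _ huT]
  exact h _ hu.1

/-- Integrating a left continuous function against a unit jump at time `s`. -/
theorem hasFollmerIntegral_step (𝒯 : PartitionSeq T) {h : Time T → ℝ} {s : Time T} (hs : ⊥ < s)
    (hh : ContinuousWithinAt h (Iic s) s) :
    HasFollmerIntegral 𝒯 h (fun u => if u < s then 0 else 1) s (h s) := by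
  have key : Tendsto (fun n => ∑ k ∈ Finset.range (𝒯.card n), (h (𝒯.pt n k) - h s) *
      ((if min (𝒯.pt n (k + 1)) s < s then 0 else 1) - (if min (𝒯.pt n k) s < s then 0 else 1)))
      atTop (𝓝 0) := by
    -- Only the cell with `t_k < s ≤ t_{k+1}` sees the step, and there `h(t_k)` is close to `h(s)`
    -- by left continuity.
    refine 𝒯.tendsto_sum_zero (P := fun n k => 𝒯.pt n k < s ∧ s ≤ 𝒯.pt n (k + 1))
      (fun n k hk k' hk' => 𝒯.eq_of_lt_le hk hk') (fun n k hk hP => ?_) fun ε hε => ?_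
    · rcases lt_or_ge (𝒯.pt n k) s with h1 | h1
      · have h2 : 𝒯.pt n (k + 1) < s := not_le.1 fun h' => hP ⟨h1, h'⟩
        simp [h1, h2]
      · have h2 := h1.trans (𝒯.lt_succ n k hk).le
        simp [not_lt.2 h1, not_lt.2 h2]
    · obtain ⟨δ, hδ, hδ'⟩ := Metric.continuousWithinAt_iff.1 hh ε hε
      filter_upwards [𝒯.mesh δ hδ] with n hn k hk hP
      have h1 : |h (𝒯.pt n k) - h s| < ε := by
        refine hδ' hP.1.le ?_
        have h2 : (𝒯.pt n k : ℝ) < s := hP.1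
        have h3 : (s : ℝ) ≤ 𝒯.pt n (k + 1) := hP.2
        rw [Subtype.dist_eq, dist_comm, Real.dist_eq, abs_of_nonneg (by linarith)]
        linarith [hn k hk]
      simpa [hP.1, not_lt.2 hP.2] using h1
  have := key.add_const (h s)
  rw [zero_add] at this
  refine this.congr fun n => ?_
  have tel : ∑ k ∈ Finset.range (𝒯.card n), ((if min (𝒯.pt n (k + 1)) s < s then (0 : ℝ) else 1) -
      (if min (𝒯.pt n k) s < s then 0 else 1)) = 1 := by
    rw [Finset.sum_range_sub (fun k => if min (𝒯.pt n k) s < s then (0 : ℝ) else 1), 𝒯.first,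
      𝒯.last]
    simp [hs]
  simp only [sub_mul (h _), Finset.sum_sub_distrib (fun k => h (𝒯.pt n k) * _)]
  rw [← Finset.mul_sum, tel, follmerSum]
  ring

/-- The difference involves the path only through `x(p ∧ t) - x(p ∧ s)`, which is `0` for `p ≤ s`
and otherwise uses times from `s` on. -/
theorem follmerSum_sub_congr (𝒯 : PartitionSeq T) (h : Time T → ℝ) {x x' : Time T → ℝ} {s t : Time T}
    (hst : s ≤ t) (hx : ∀ u, s ≤ u → x u = x' u) (n : ℕ) :
    follmerSum 𝒯 h x t n - follmerSum 𝒯 h x s n =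
      follmerSum 𝒯 h x' t n - follmerSum 𝒯 h x' s n := by
  have e : ∀ p, x (min p t) - x (min p s) = x' (min p t) - x' (min p s) := fun p => by
    rcases le_or_gt p s with hp | hp
    · simp [min_eq_left hp, min_eq_left (hp.trans hst)]
    · rw [min_eq_right hp.le, hx _ le_rfl, hx _ (le_min hp.le hst)]
  simp only [follmerSum, ← Finset.sum_sub_distrib]
  refine Finset.sum_congr rfl fun k _ => ?_
  linear_combination h (𝒯.pt n k) * (e (𝒯.pt n (k + 1)) - e (𝒯.pt n k))

theorem IsCadlag.comp_leftVal_bound {T : ℝ} {x : Time T → ℝ} (hx : IsCadlag x) {g : Time T → ℝ → ℝ}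
    (hg : Continuous (Function.uncurry g)) : ∃ B, ∀ t, |g t (leftVal x t)| ≤ B :=
  let ⟨B, _, hB⟩ := (hx.isCaglad_leftVal.comp hg).isRegulated.exists_bound
  ⟨B, hB⟩

/-- Itô's formula for paths with finitely many jumps. -/
theorem JumpPath.hasFollmerIntegral {𝒯 : PartitionSeq T} {z : Time T → ℝ}
    (hz : z ∈ diffusionPaths 𝒯) {x₀ σ : ℝ} {C : Set ℝ} {r : Time T} {c : ℝ} {x : Time T → ℝ}
    (h : JumpPath (fun t => x₀ * Real.exp (σ * z t)) C r c x) (f : SmoothIntegrand T)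
    (t : Time T) :
    HasFollmerIntegral 𝒯 (fun s => f.f s (leftVal x s)) x t (f.itoValue σ x t) := by
  have hy : Continuous fun t => x₀ * Real.exp (σ * z t) := by have := hz.1; fun_prop
  induction h generalizing t with
  | start =>
    have hl : ∀ t, leftVal (fun t => x₀ * Real.exp (σ * z t)) t = x₀ * Real.exp (σ * z t) :=
      fun t => leftVal_eq_of_continuousAt hy.continuousAt
    have := f.hasFollmerIntegral_path 𝒯 hz x₀ σ (fun t => rfl) t
    simpa [SmoothIntegrand.itoValue, hl, f.jumpTerm_self] using this
  | @jump r c x s a hx hrs ha ih =>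
    have hs : ⊥ < s := bot_le.trans_lt hrs
    have hxc := hx.isCadlag hy
    obtain ⟨E, hE⟩ := hx.exists_finset hy
    set w : Time T → ℝ := fun t => c * (1 + a) * (x₀ * Real.exp (σ * z t)) with hw
    have hwc : Continuous w := by fun_prop
    have hgc : IsCadlag (glue s x w) := hxc.glue hwc
    have hleft : ∀ u ≤ s, leftVal (glue s x w) u = leftVal x u := fun u hu =>
      leftVal_glue_of_le w hxc hs hu
    rcases lt_or_ge t s with hts | hts
    · have h1 : f.itoValue σ (glue s x w) t = f.itoValue σ x t := by
        rw [SmoothIntegrand.itoValue, SmoothIntegrand.itoValue, glue_of_lt x w hts,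
          glue_of_lt x w hs]
        congr 1
        · congr 1
          exact timeIntegral_congr fun u hu => by rw [glue_of_lt x w (hu.trans hts)]
        · refine finsum_congr fun u => ?_
          by_cases hu : u ≤ t
          · rw [if_pos hu, if_pos hu, hleft u (hu.trans hts.le), glue_of_lt x w (hu.trans_lt hts)]
          · rw [if_neg hu, if_neg hu]
      rw [h1]
      refine (ih t).congr fun n => (follmerSum_congr (fun u hu => ?_) (fun u hu => ?_) n).symm
      · rw [hleft u (hu.trans hts).le]
      · exact glue_of_lt x w (hu.trans_lt hts)
    · have hI := fun t => f.hasFollmerIntegral_path 𝒯 hz (c * (1 + a) * x₀) σ (w := w)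
        (fun t => by rw [hw]; ring) t
      have hxs : leftVal x s = x s := leftVal_eq_of_continuousAt (hx.continuousAt_of_lt hy hrs)
      -- On `[0, s]` the glued path is `x` plus a step of height `w s - x s` at `s`, and Föllmer
      -- sums are linear in the integrator.
      have l1 : Tendsto (follmerSum 𝒯 (fun u => f.f u (leftVal (glue s x w) u)) (glue s x w) s)
          atTop (𝓝 (f.itoValue σ x s + (w s - x s) * f.f s (x s))) := by
        have hcag : IsCaglad fun u => f.f u (leftVal x u) := hxc.isCaglad_leftVal.comp f.cont_f
        have hst := hasFollmerIntegral_step 𝒯 hs (hcag s).1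
        simp only [hxs] at hst
        refine (Tendsto.add (ih s) (hst.const_mul (w s - x s))).congr fun n => ?_
        rw [follmerSum_congr (y := fun u => f.f u (leftVal (glue s x w) u))
          (y' := fun u => f.f u (leftVal x u)) (x := glue s x w)
          (x' := fun u => x u + (w s - x s) * (if u < s then 0 else 1))
          (fun u hu => by rw [hleft u hu.le]) (fun u hu => ?_)]
        · simp only [follmerSum, Finset.mul_sum, ← Finset.sum_add_distrib]
          exact Finset.sum_congr rfl fun k _ => by ring
        · rcases hu.lt_or_eq with hu | rfl
          · simp [hu, glue_of_lt x w hu]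
          · simp [glue_of_le x w le_rfl]
      -- After `s` path and left limits coincide with the continuous `w`, so the increment is that
      -- of the continuous formula.
      have l2 : Tendsto (fun n =>
          follmerSum 𝒯 (fun u => f.f u (leftVal (glue s x w) u)) (glue s x w) t n -
          follmerSum 𝒯 (fun u => f.f u (leftVal (glue s x w) u)) (glue s x w) s n) atTop
          (𝓝 ((primitive f.f t (w t) - primitive f.f ⊥ (w ⊥) -
            timeIntegral (fun s => f.drift σ s (w s)) t) -
            (primitive f.f s (w s) - primitive f.f ⊥ (w ⊥) -
            timeIntegral (fun s => f.drift σ s (w s)) s))) := by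
        obtain ⟨B, hB⟩ := hgc.comp_leftVal_bound f.cont_f
        obtain ⟨B', -, hB'⟩ := ((isCadlag_of_continuous hwc).comp f.cont_f).isRegulated.exists_bound
        have := tendsto_follmerSum_sub_of_eqOn 𝒯 (fun t => hwc.continuousWithinAt) hB hB' hts
          (fun u hu => by rw [leftVal_glue_of_lt x hwc hu.1]) (Tendsto.sub (hI t) (hI s))
        refine this.congr fun n => ?_
        exact (follmerSum_sub_congr 𝒯 _ hts (fun u hu => glue_of_le x w hu) n).symm
      have hval : f.itoValue σ (glue s x w) t =
          (f.itoValue σ x s + (w s - x s) * f.f s (x s)) +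
          ((primitive f.f t (w t) - primitive f.f ⊥ (w ⊥) -
            timeIntegral (fun s => f.drift σ s (w s)) t) -
            (primitive f.f s (w s) - primitive f.f ⊥ (w ⊥) -
            timeIntegral (fun s => f.drift σ s (w s)) s)) := by
        have hint : timeIntegral (fun u => f.drift σ u (glue s x w u)) t -
            timeIntegral (fun u => f.drift σ u (x u)) s =
            timeIntegral (fun s => f.drift σ s (w s)) t -
            timeIntegral (fun s => f.drift σ s (w s)) s := by
          have e1 : timeIntegral (fun u => f.drift σ u (x u)) s =
              timeIntegral (fun u => f.drift σ u (glue s x w u)) s :=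
            timeIntegral_congr fun u hu => by rw [glue_of_lt x w hu]
          rw [e1]
          exact timeIntegral_sub_congr (hgc.comp (f.continuous_drift σ)).isRegulated
            ((isCadlag_of_continuous hwc).comp (f.continuous_drift σ)).isRegulated hts
            fun u hu => by rw [glue_of_le x w hu]
        have hjump : (∑ᶠ u, if u ≤ t then
              f.jumpTerm u (leftVal (glue s x w) u) (glue s x w u) else 0) =
            f.jumpTerm s (x s) (w s) +
              ∑ᶠ u, if u ≤ s then f.jumpTerm u (leftVal x u) (x u) else 0 := by
          classical
          -- `x` is continuous from `s` on, since its last jump is at `r < s`; the glued path adds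
          -- the single jump time `s`.
          rw [f.finsum_jumpTerm (x := glue s x w) (E := insert s (E.filter (· < s))),
            f.finsum_jumpTerm (x := x) (E := E.filter (· < s)), Finset.sum_insert (by simp),
            if_pos hts, hleft s le_rfl, hxs, glue_of_le x w le_rfl]
          · congr 1
            refine Finset.sum_congr rfl fun u hu => ?_
            have hus : u < s := (Finset.mem_filter.1 hu).2
            rw [if_pos (hus.le.trans hts), if_pos hus.le, hleft u hus.le, glue_of_lt x w hus]
          · intro u hu
            refine Finset.mem_filter.2 ⟨hE u hu, not_le.1 fun hsu => hu ?_⟩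
            exact leftVal_eq_of_continuousAt (hx.continuousAt_of_lt hy (hrs.trans_le hsu))
          · intro u hu
            rcases lt_trichotomy u s with h | h | h
            · rw [hleft u h.le, glue_of_lt x w h] at hu
              exact Finset.mem_insert_of_mem (Finset.mem_filter.2 ⟨hE u hu, h⟩)
            · simp [h]
            · exact absurd (by rw [leftVal_glue_of_lt x hwc h, glue_of_le x w h.le]) hu
        rw [SmoothIntegrand.itoValue, SmoothIntegrand.itoValue, hjump, glue_of_le x w hts,
          glue_of_lt x w hs, SmoothIntegrand.jumpTerm]
        linear_combination (-1 : ℝ) * hint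
      rw [hval]
      exact (l1.add l2).congr fun n => by ring

/-! ### Regularity of the integral in the upper limit -/

theorem tendsto_of_continuous_uncurry {T : ℝ} {ι : Type*} {g : Time T → ℝ → ℝ}
    (hg : Continuous (Function.uncurry g)) {l : Filter ι} {a : ι → Time T} {b : ι → ℝ} {a' : Time T}
    {b' : ℝ} (ha : Tendsto a l (𝓝 a')) (hb : Tendsto b l (𝓝 b')) :
    Tendsto (fun i => g (a i) (b i)) l (𝓝 (g a' b')) :=
  (hg.tendsto (a', b')).comp (ha.prodMk_nhds hb)

theorem continuous_timeIntegral {g : Time T → ℝ} (hg : IsRegulated g) :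
    Continuous (timeIntegral g) := by
  obtain ⟨B, -, hB⟩ := hg.exists_bound
  exact (intervalIntegral.continuous_primitive
    (fun a b => intervalIntegrable_comp_projIcc hg.measurable hB a b) 0).comp continuous_subtype_val

/-- Right continuity and left limits in one statement: `p s` records whether the jump at `s` is
counted along `l`, namely `s ≤ t` from the right and `s < t` from the left. -/
theorem SmoothIntegrand.tendsto_itoValue (f : SmoothIntegrand T) (σ : ℝ) {x : Time T → ℝ}
    (hx : IsCadlag x) {E : Finset (Time T)} (hE : ∀ t, leftVal x t ≠ x t → t ∈ E) {t : Time T}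
    {l : Filter (Time T)} {v : ℝ} (hl : l ≤ 𝓝 t) (hv : Tendsto x l (𝓝 v)) {p : Time T → Prop}
    [DecidablePred p] (hp : ∀ s, ∀ᶠ u in l, s ≤ u ↔ p s) :
    Tendsto (f.itoValue σ x) l (𝓝 (primitive f.f t v - primitive f.f ⊥ (x ⊥) -
      timeIntegral (fun s => f.drift σ s (x s)) t -
      ∑ s ∈ E, if p s then f.jumpTerm s (leftVal x s) (x s) else 0)) := by
  refine ((Tendsto.sub_const ?_ _).sub ?_).sub ?_
  · exact tendsto_of_continuous_uncurry (continuous_primitive f.cont_f) (tendsto_id.mono_right hl) hv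
  · exact ((continuous_timeIntegral (hx.comp (f.continuous_drift σ)).isRegulated).tendsto t).mono_left
      hl
  · simp_rw [f.finsum_jumpTerm hE]
    refine tendsto_finsetSum _ fun s _ => tendsto_const_nhds.congr' ?_
    filter_upwards [hp s] with u hu
    simp only [hu]

theorem SmoothIntegrand.itoValue_rightCont (f : SmoothIntegrand T) (σ : ℝ) {x : Time T → ℝ}
    (hx : IsCadlag x) {E : Finset (Time T)} (hE : ∀ t, leftVal x t ≠ x t → t ∈ E) (t : Time T) :
    ContinuousWithinAt (f.itoValue σ x) (Ici t) t := by
  have := f.tendsto_itoValue σ hx hE nhdsWithin_le_nhds (hx t).1 (p := fun s => s ≤ t) fun s => by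
    rcases le_or_gt s t with h | h
    · filter_upwards [self_mem_nhdsWithin] with u hu
      exact iff_of_true (h.trans hu) h
    · filter_upwards [nhdsWithin_le_nhds (Iio_mem_nhds h)] with u hu
      exact iff_of_false (not_le.2 hu) (not_le.2 h)
  rw [← f.finsum_jumpTerm hE] at this
  exact this

/-- At `t` the primitive jumps by `F(t,x(t)) - F(t,x(t-))`, and subtracting the jump term leaves
`f(t,x(t-)) Δx(t)`. -/
theorem SmoothIntegrand.itoValue_leftLim (f : SmoothIntegrand T) (σ : ℝ) {x : Time T → ℝ}
    (hx : IsCadlag x) {E : Finset (Time T)} (hE : ∀ t, leftVal x t ≠ x t → t ∈ E) (t : Time T) :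
    Tendsto (f.itoValue σ x) (𝓝[<] t)
      (𝓝 (f.itoValue σ x t - f.f t (leftVal x t) * (x t - leftVal x t))) := by
  classical
  have := f.tendsto_itoValue σ hx hE nhdsWithin_le_nhds (tendsto_leftVal (hx t).2)
    (p := fun s => s < t) fun s => by
    rcases lt_or_ge s t with h | h
    · filter_upwards [nhdsWithin_le_nhds (Ioi_mem_nhds h)] with u hu
      exact iff_of_true (le_of_lt hu) h
    · filter_upwards [self_mem_nhdsWithin] with u hu
      exact iff_of_false (not_le.2 (lt_of_lt_of_le hu h)) (not_lt.2 h)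
  convert this using 2
  have hsum : (∑ s ∈ E, if s ≤ t then f.jumpTerm s (leftVal x s) (x s) else 0) -
      (∑ s ∈ E, if s < t then f.jumpTerm s (leftVal x s) (x s) else 0) =
      f.jumpTerm t (leftVal x t) (x t) := by
    rw [← Finset.sum_sub_distrib]
    have e : ∀ s ∈ E, ((if s ≤ t then f.jumpTerm s (leftVal x s) (x s) else 0) -
        (if s < t then f.jumpTerm s (leftVal x s) (x s) else 0)) =
        if s = t then f.jumpTerm t (leftVal x t) (x t) else 0 := fun s _ => by
      rcases lt_trichotomy s t with h | h | h
      · simp [h, h.le, h.ne]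
      · subst h; simp
      · simp [not_le.2 h, not_lt.2 h.le, h.ne']
    rw [Finset.sum_congr rfl e, Finset.sum_ite_eq' E t]
    by_cases ht : t ∈ E
    · rw [if_pos ht]
    · have : leftVal x t = x t := not_not.1 fun h => ht (hE t h)
      rw [if_neg ht, this, f.jumpTerm_self]
  rw [itoValue, f.finsum_jumpTerm hE]
  rw [jumpTerm] at hsum
  linear_combination (-1 : ℝ) * hsum

/-! ### Convergence in the Skorohod metric -/

/-- The infimum in the metric need not be attained; time changes optimal up to `1/(n+1)` suffice. -/
theorem exists_timeChange {u : ℕ → RCLL T} {x : RCLL T} (h : Tendsto u atTop (𝓝 x)) :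
    ∃ l : ℕ → (Time T ≃o Time T), ∀ ε > 0, ∀ᶠ n in atTop,
      ∀ t, dist (l n t) t < ε ∧ |u n t - x (l n t)| < ε := by
  have hex : ∀ n : ℕ, ∃ l : Time T ≃o Time T, max (⨆ t, edist (l t) t)
      (⨆ t, edist (u n t) (x (l t))) ≤ edist (u n) x + ENNReal.ofReal (1 / ((n : ℝ) + 1)) := by
    intro n
    have hpos : ENNReal.ofReal (1 / ((n : ℝ) + 1)) ≠ 0 :=
      (ENNReal.ofReal_pos.2 (by positivity)).ne'
    -- At infinite distance the strict inequality is not available, but then the bound is void.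
    by_cases htop : edist (u n) x = ⊤
    · exact ⟨OrderIso.refl _, by simp [htop]⟩
    · have hlt : skorohodDist (u n) x < edist (u n) x + ENNReal.ofReal (1 / ((n : ℝ) + 1)) :=
        ENNReal.lt_add_right htop hpos
      obtain ⟨l, hl⟩ := iInf_lt_iff.1 hlt
      exact ⟨l, hl.le⟩
  choose l hl using hex
  refine ⟨l, fun ε hε => ?_⟩
  have hlim : Tendsto (fun n : ℕ => edist (u n) x + ENNReal.ofReal (1 / ((n : ℝ) + 1))) atTop
      (𝓝 0) := by
    have h1 := tendsto_iff_edist_tendsto_0.1 h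
    have h2 := (ENNReal.continuous_ofReal.tendsto 0).comp
      (tendsto_one_div_add_atTop_nhds_zero_nat (𝕜 := ℝ))
    simpa using h1.add h2
  filter_upwards [hlim.eventually_lt_const (ENNReal.ofReal_pos.2 hε)] with n hn t
  have h1 : edist (l n t) t ≤ _ :=
    (le_iSup (fun t => edist (l n t) t) t).trans ((le_max_left _ _).trans (hl n))
  have h2 : edist (u n t) (x (l n t)) ≤ _ :=
    (le_iSup (fun t => edist (u n t) (x (l n t))) t).trans ((le_max_right _ _).trans (hl n))
  rw [← Real.dist_eq, ← edist_lt_ofReal, ← edist_lt_ofReal]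
  exact ⟨h1.trans_lt hn, h2.trans_lt hn⟩

/-- An order automorphism is continuous and strictly increasing, so it maps left neighbourhoods of
`t` to those of `l t` and the bound passes to left limits; it also fixes `⊥`. -/
theorem abs_leftVal_sub_le {u x : Time T → ℝ} (hu : IsCadlag u) (hx : IsCadlag x)
    (l : Time T ≃o Time T) {ε : ℝ} (h : ∀ t, |u t - x (l t)| ≤ ε) (t : Time T) :
    |leftVal u t - leftVal x (l t)| ≤ ε := by
  rcases eq_or_ne t ⊥ with rfl | ht
  · rw [l.map_bot, leftVal_bot, leftVal_bot]
    simpa using h ⊥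
  · have := neBot_nhdsLT ht
    have hl : Tendsto l (𝓝[<] t) (𝓝[<] (l t)) :=
      tendsto_nhdsWithin_of_tendsto_nhds_of_eventually_within _
        (l.continuous.continuousAt.tendsto.mono_left nhdsWithin_le_nhds) (by
          filter_upwards [self_mem_nhdsWithin] with s hs using l.strictMono hs)
    exact le_of_tendsto ((tendsto_leftVal (hu t).2).sub
      ((tendsto_leftVal (hx (l t)).2).comp hl)).abs (Eventually.of_forall h)

/-- Dominated convergence off a countable set, while moving the upper limit costs at most `K |ρ n -
ρ'|`. -/
theorem tendsto_timeIntegral {g : ℕ → Time T → ℝ} {g' : Time T → ℝ} (hg : ∀ n, IsRegulated (g n))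
    {K : ℝ} (hK : ∀ᶠ n in atTop, ∀ t, |g n t| ≤ K) {D : Set (Time T)} (hD : D.Countable)
    (hlim : ∀ t ∉ D, Tendsto (fun n => g n t) atTop (𝓝 (g' t))) {ρ : ℕ → Time T} {ρ' : Time T}
    (hρ : Tendsto ρ atTop (𝓝 ρ')) :
    Tendsto (fun n => timeIntegral (g n) (ρ n)) atTop (𝓝 (timeIntegral g' ρ')) := by
  have h1 : Tendsto (fun n => timeIntegral (g n) ρ') atTop (𝓝 (timeIntegral g' ρ')) := by
    refine intervalIntegral.tendsto_integral_filter_of_dominated_convergence (fun _ => K)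
      (Eventually.of_forall fun n => (measurable_comp_projIcc (hg n).measurable).aestronglyMeasurable)
      (hK.mono fun n hn => MeasureTheory.ae_of_all _ fun s _ => hn _) intervalIntegrable_const ?_
    have hnull : MeasureTheory.volume ((fun t : Time T => (t : ℝ)) '' D) = 0 :=
      (hD.image _).measure_zero _
    filter_upwards [MeasureTheory.measure_eq_zero_iff_ae_notMem.1 hnull] with s hs hst
    rw [uIoc_of_le ρ'.2.1] at hst
    have hsT : s ∈ Icc (0 : ℝ) T := ⟨hst.1.le, hst.2.trans ρ'.2.2⟩
    rw [projIcc_of_mem _ hsT]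
    exact hlim _ fun h => hs ⟨_, h, rfl⟩
  have h2 : Tendsto (fun n => timeIntegral (g n) (ρ n) - timeIntegral (g n) ρ') atTop (𝓝 0) := by
    have h3 : Tendsto (fun n => K * |(ρ n : ℝ) - ρ'|) atTop (𝓝 0) := by
      have := (((continuous_subtype_val.tendsto ρ').comp hρ).sub_const (ρ' : ℝ)).abs.const_mul K
      simpa using this
    refine squeeze_zero_norm' ?_ h3
    filter_upwards [hK] with n hn
    rw [timeIntegral_sub (hg n)]
    exact intervalIntegral.norm_integral_le_of_norm_le_const fun s _ => hn _
  simpa using h2.add h1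

theorem tendsto_apply_of_continuousAt {T : ℝ} {u : ℕ → RCLL T} {x : RCLL T} {l : ℕ → (Time T ≃o Time T)}
    (hl : ∀ ε > 0, ∀ᶠ n in atTop, ∀ t, dist (l n t) t < ε ∧ |u n t - x (l n t)| < ε) {t : Time T}
    (ht : ContinuousAt x.toFun t) : Tendsto (fun n => u n t) atTop (𝓝 (x t)) := by
  have h1 : Tendsto (fun n => l n t) atTop (𝓝 t) :=
    Metric.tendsto_nhds.2 fun ε hε => (hl ε hε).mono fun n hn => (hn t).1
  have h2 : Tendsto (fun n => u n t - x (l n t)) atTop (𝓝 0) :=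
    Metric.tendsto_nhds.2 fun ε hε => (hl ε hε).mono fun n hn => by simpa using (hn t).2
  simpa using h2.add (ht.tendsto.comp h1)

/-- The time matched to `e` is `(l n).symm e`, where value and left limit converge to those of `x`
at `e`. The question is whether it is counted up to `ρ n`. If `x` has no jump at `e`, the term tends
to `0` either way; if `e ≠ ρ'`, the order is eventually decided by `l n (ρ n) → ρ'`. -/
theorem SmoothIntegrand.tendsto_jumpTerm (f : SmoothIntegrand T)
    {u : ℕ → RCLL T} {x : RCLL T} {l : ℕ → (Time T ≃o Time T)}
    (hl : ∀ ε > 0, ∀ᶠ n in atTop, ∀ t, dist (l n t) t < ε ∧ |u n t - x (l n t)| < ε)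
    {ρ : ℕ → Time T} {ρ' : Time T} (hρ : Tendsto ρ atTop (𝓝 ρ'))
    (hxρ : Tendsto (fun n => u n (ρ n)) atTop (𝓝 (x ρ'))) (e : Time T) :
    Tendsto (fun n => if (l n).symm e ≤ ρ n then
      f.jumpTerm ((l n).symm e) (leftVal (u n).toFun ((l n).symm e)) (u n ((l n).symm e)) else 0)
      atTop (𝓝 (if e ≤ ρ' then f.jumpTerm e (leftVal x.toFun e) (x e) else 0)) := by
  have hdiff : ∀ t : ℕ → Time T, Tendsto (fun n => u n (t n) - x (l n (t n))) atTop (𝓝 0) := fun t =>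
    Metric.tendsto_nhds.2 fun ε hε => (hl ε hε).mono fun n hn => by simpa using (hn (t n)).2
  have hlρ : Tendsto (fun n => l n (ρ n)) atTop (𝓝 ρ') := by
    have h0 : Tendsto (fun n => dist (l n (ρ n)) (ρ n)) atTop (𝓝 0) :=
      Metric.tendsto_nhds.2 fun ε hε => (hl ε hε).mono fun n hn => by
        simpa [abs_of_nonneg] using (hn (ρ n)).1
    refine tendsto_iff_dist_tendsto_zero.2 (squeeze_zero (fun _ => dist_nonneg)
      (fun n => dist_triangle _ (ρ n) _) ?_)
    simpa using h0.add (tendsto_iff_dist_tendsto_zero.1 hρ)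
  have hxl : Tendsto (fun n => x (l n (ρ n))) atTop (𝓝 (x ρ')) := by
    simpa using hxρ.sub (hdiff ρ)
  have h1 : Tendsto (fun n => (l n).symm e) atTop (𝓝 e) :=
    Metric.tendsto_nhds.2 fun ε hε => (hl ε hε).mono fun n hn => by
      simpa [dist_comm] using (hn ((l n).symm e)).1
  have h2 : Tendsto (fun n => u n ((l n).symm e)) atTop (𝓝 (x e)) := by
    simpa using (hdiff fun n => (l n).symm e).add_const (x e)
  have h3 : Tendsto (fun n => leftVal (u n).toFun ((l n).symm e)) atTop
      (𝓝 (leftVal x.toFun e)) := by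
    refine Metric.tendsto_nhds.2 fun ε hε => (hl (ε / 2) (by positivity)).mono fun n hn => ?_
    have := abs_leftVal_sub_le (u n).isCadlag x.isCadlag (l n) (fun t => (hn t).2.le)
      ((l n).symm e)
    rw [OrderIso.apply_symm_apply] at this
    rw [Real.dist_eq]
    linarith
  have hJ : Tendsto (fun n => f.jumpTerm ((l n).symm e) (leftVal (u n).toFun ((l n).symm e))
      (u n ((l n).symm e))) atTop (𝓝 (f.jumpTerm e (leftVal x.toFun e) (x e))) :=
    ((tendsto_of_continuous_uncurry (continuous_primitive f.cont_f) h1 h2).sub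
      (tendsto_of_continuous_uncurry (continuous_primitive f.cont_f) h1 h3)).sub
      ((tendsto_of_continuous_uncurry f.cont_f h1 h3).mul (h2.sub h3))
  by_cases he : leftVal x.toFun e = x e
  · rw [he, f.jumpTerm_self] at hJ ⊢
    rw [ite_self]
    refine squeeze_zero_norm (fun n => ?_) (by simpa using hJ.norm)
    split_ifs <;> simp
  · have hiff : ∀ᶠ n in atTop, (l n).symm e ≤ ρ n ↔ e ≤ ρ' := by
      have hs : ∀ n, (l n).symm e ≤ ρ n ↔ e ≤ l n (ρ n) := fun n => (l n).symm_apply_le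
      simp only [hs]
      rcases lt_trichotomy e ρ' with h | h | h
      · filter_upwards [hlρ.eventually_const_lt h] with n hn
        exact iff_of_true hn.le h.le
      · subst h
        -- Critical case `e = ρ'` with a jump: `l n (ρ n) < e` would put `x (l n (ρ n))` near the
        -- left limit at `e`, whereas `hxρ` makes it tend to `x e`.
        obtain ⟨U, W, hU, hW, hxU, hxW, hUW⟩ := t2_separation he
        have hl1 : ∀ᶠ s in 𝓝 e, s < e → x s ∈ U := eventually_nhdsWithin_iff.1
          (tendsto_leftVal (x.left_lim e) (hU.mem_nhds hxU))
        filter_upwards [hlρ.eventually hl1, hxl (hW.mem_nhds hxW)] with n hn1 hn2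
        refine iff_of_true (not_lt.1 fun hlt => ?_) le_rfl
        exact disjoint_left.1 hUW (hn1 hlt) hn2
      · filter_upwards [hlρ.eventually_lt_const h] with n hn
        exact iff_of_false (not_le.2 hn) (not_le.2 h)
    have hlim : Tendsto (fun n => if e ≤ ρ' then f.jumpTerm ((l n).symm e)
        (leftVal (u n).toFun ((l n).symm e)) (u n ((l n).symm e)) else 0) atTop
        (𝓝 (if e ≤ ρ' then f.jumpTerm e (leftVal x.toFun e) (x e) else 0)) := by
      split_ifs
      · exact hJ
      · exact tendsto_const_nhds
    refine hlim.congr' ?_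
    filter_upwards [hiff] with n hn
    simp only [hn]

/-- Continuity of the integral, as a function of the path and of the upper limit. -/
theorem SmoothIntegrand.tendsto_itoValue_of_tendsto (f : SmoothIntegrand T) (σ : ℝ)
    {u : ℕ → RCLL T} {x : RCLL T} {l : ℕ → (Time T ≃o Time T)}
    (hl : ∀ ε > 0, ∀ᶠ n in atTop, ∀ t, dist (l n t) t < ε ∧ |u n t - x (l n t)| < ε)
    {E : Finset (Time T)} (hE : ∀ t, leftVal x.toFun t ≠ x t → t ∈ E)
    (hjump : ∀ᶠ n in atTop, ∀ t, leftVal (u n).toFun t ≠ u n t → l n t ∈ E)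
    {ρ : ℕ → Time T} {ρ' : Time T} (hρ : Tendsto ρ atTop (𝓝 ρ'))
    (hxρ : Tendsto (fun n => u n (ρ n)) atTop (𝓝 (x ρ'))) :
    Tendsto (fun n => f.itoValue σ (u n).toFun (ρ n)) atTop (𝓝 (f.itoValue σ x.toFun ρ')) := by
  classical
  have hdiff : ∀ t : ℕ → Time T, Tendsto (fun n => u n (t n) - x (l n (t n))) atTop (𝓝 0) := fun t =>
    Metric.tendsto_nhds.2 fun ε hε => (hl ε hε).mono fun n hn => by simpa using (hn (t n)).2
  have hcont : Tendsto (fun n => primitive f.f (ρ n) (u n (ρ n))) atTop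
      (𝓝 (primitive f.f ρ' (x ρ'))) :=
    tendsto_of_continuous_uncurry (continuous_primitive f.cont_f) hρ hxρ
  have hbot : Tendsto (fun n => primitive f.f ⊥ (u n ⊥)) atTop (𝓝 (primitive f.f ⊥ (x ⊥))) := by
    have h1 : Tendsto (fun n => u n ⊥) atTop (𝓝 (x ⊥)) := by
      have := (hdiff fun _ => ⊥).add_const (x ⊥)
      simpa using this
    exact tendsto_of_continuous_uncurry (continuous_primitive f.cont_f) tendsto_const_nhds h1
  have hint : Tendsto (fun n => timeIntegral (fun s => f.drift σ s (u n s)) (ρ n)) atTop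
      (𝓝 (timeIntegral (fun s => f.drift σ s (x s)) ρ')) := by
    obtain ⟨R, -, hR⟩ := x.isCadlag.isRegulated.exists_bound
    obtain ⟨K, -, hK⟩ := exists_bound (f.continuous_drift σ) (R + 1)
    refine tendsto_timeIntegral (fun n => ((u n).isCadlag.comp (f.continuous_drift σ)).isRegulated)
      (K := K) ?_ x.isCadlag.isRegulated.countable_not_continuousAt (fun t ht => ?_) hρ
    · filter_upwards [hl 1 one_pos] with n hn t
      refine hK _ _ ?_
      have h1 := (hn t).2
      have h2 := abs_add_le (u n t - x (l n t)) (x (l n t))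
      rw [sub_add_cancel] at h2
      linarith [hR (l n t)]
    · have h1 := tendsto_apply_of_continuousAt hl (not_not.1 ht)
      exact tendsto_of_continuous_uncurry (f.continuous_drift σ) tendsto_const_nhds h1
  have hsum : Tendsto (fun n => ∑ᶠ s, if s ≤ ρ n then
      f.jumpTerm s (leftVal (u n).toFun s) (u n s) else 0) atTop
      (𝓝 (∑ᶠ s, if s ≤ ρ' then f.jumpTerm s (leftVal x.toFun s) (x s) else 0)) := by
    rw [f.finsum_jumpTerm hE]
    refine (tendsto_finsetSum E fun e _ => f.tendsto_jumpTerm hl hρ hxρ e).congr' ?_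
    filter_upwards [hjump] with n hn
    -- By `hjump`, pulling `E` back by the time change covers all jumps of `u n`.
    rw [f.finsum_jumpTerm (E := E.map (l n).symm.toEmbedding) fun t ht => ?_, Finset.sum_map]
    · rfl
    · exact Finset.mem_map.2 ⟨l n t, hn t ht, by simp⟩
  exact ((hcont.sub hbot).sub hint).sub hsum

/-- For large `n`, the jumps of `u n` are near the jumps of the limit path `x`. -/
theorem eventually_jump_of_jump {u : ℕ → RCLL T} {x : RCLL T} {l : ℕ → (Time T ≃o Time T)}
    (hl : ∀ ε > 0, ∀ᶠ n in atTop, ∀ t, dist (l n t) t < ε ∧ |u n t - x (l n t)| < ε)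
    {m δ : ℝ} (hm : 0 < m) (hδ : 0 < δ) (hx : ∀ t, m ≤ |x t|)
    (hu : ∀ n t, leftVal (u n).toFun t ≠ u n t →
      δ * |leftVal (u n).toFun t| ≤ |u n t - leftVal (u n).toFun t|) :
    ∀ᶠ n in atTop, ∀ t, leftVal (u n).toFun t ≠ u n t → leftVal x.toFun (l n t) ≠ x (l n t) := by
  -- The bound `m / 2` keeps the left limit of `u n` at least `m / 2` in modulus, so its jump is at
  -- least `δ m / 2`; without a jump of `x` it would be at most `2 · δ m / 8`.
  have hε : 0 < min (m / 2) (δ * m / 8) := by positivity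
  filter_upwards [hl _ hε] with n hn t ht heq
  have h1 := (hn t).2
  have h2 := abs_leftVal_sub_le (u n).isCadlag x.isCadlag (l n) (fun t => (hn t).2.le) t
  rw [heq] at h2
  have h3 := hu n t ht
  have h4 : |u n t - leftVal (u n).toFun t| ≤ 2 * min (m / 2) (δ * m / 8) := by
    rw [abs_sub_comm] at h2
    linarith [abs_sub_le (u n t) (x (l n t)) (leftVal (u n).toFun t)]
  have h5 : m / 2 ≤ |leftVal (u n).toFun t| := by
    have h6 := abs_sub_abs_le_abs_sub (x (l n t)) (leftVal (u n).toFun t)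
    rw [abs_sub_comm (x (l n t))] at h6
    linarith [hx (l n t), min_le_left (m / 2) (δ * m / 8)]
  have h7 : δ * (m / 2) ≤ δ * |leftVal (u n).toFun t| := mul_le_mul_of_nonneg_left h5 hδ.le
  have h8 : 0 < δ * m := by positivity
  linarith [min_le_right (m / 2) (δ * m / 8)]

/-! ### Integrands on `[0,T] × ℝ` -/

/-- The strip has unique derivatives, so the derivative within it is continuous up to the boundary.
Slices in `u` are whole lines and have two-sided derivatives; in time, differentiability in the
interior is enough for the mean value property. -/
theorem exists_smoothIntegrand {φ : ℝ → ℝ → ℝ}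
    (hφ : ContDiffOn ℝ 1 (fun p : ℝ × ℝ => φ p.1 p.2) (Set.Icc 0 T ×ˢ Set.univ)) :
    ∃ f : SmoothIntegrand T, ∀ (s : Time T) (u : ℝ), f.f s u = φ s u := by
  have hT : 0 < T := Fact.out
  set g : ℝ × ℝ → ℝ := fun p => φ p.1 p.2 with hg
  set S : Set (ℝ × ℝ) := Set.Icc 0 T ×ˢ Set.univ with hS
  have hSu : UniqueDiffOn ℝ S := (uniqueDiffOn_Icc hT).prod uniqueDiffOn_univ
  have hmem : ∀ (s : Time T) (u : ℝ), ((s : ℝ), u) ∈ S := fun s u => ⟨s.2, trivial⟩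
  have hd : ∀ p ∈ S, HasFDerivWithinAt g (fderivWithin ℝ g S p) S p := fun p hp =>
    ((hφ.differentiableOn one_ne_zero) p hp).hasFDerivWithinAt
  have hdc : ContinuousOn (fderivWithin ℝ g S) S := hφ.continuousOn_fderivWithin hSu le_rfl
  have hι : Continuous fun p : Time T × ℝ => ((p.1 : ℝ), p.2) :=
    (continuous_subtype_val.comp continuous_fst).prodMk continuous_snd
  have hdc' : Continuous fun p : Time T × ℝ => fderivWithin ℝ g S ((p.1 : ℝ), p.2) :=
    hdc.comp_continuous hι fun p => hmem p.1 p.2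
  have hdt : ∀ (r u : ℝ), r ∈ Icc 0 T →
      HasDerivWithinAt (fun r => φ r u) (fderivWithin ℝ g S (r, u) (1, 0)) (Icc 0 T) r := by
    intro r u hr
    have h1 : HasDerivWithinAt (fun r : ℝ => (r, u)) ((1 : ℝ), (0 : ℝ)) (Icc 0 T) r :=
      ((hasDerivAt_id r).prodMk (hasDerivAt_const r u)).hasDerivWithinAt
    exact (hd (r, u) ⟨hr, trivial⟩).comp_hasDerivWithinAt r h1
      (show MapsTo _ _ S from fun r' hr' => ⟨hr', trivial⟩)
  refine ⟨{
    f := fun s u => φ s u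
    ft := fun s u => fderivWithin ℝ g S ((s : ℝ), u) (1, 0)
    fx := fun s u => fderivWithin ℝ g S ((s : ℝ), u) (0, 1)
    cont_f := hφ.continuousOn.comp_continuous hι fun p => hmem p.1 p.2
    cont_ft := hdc'.clm_apply continuous_const
    cont_fx := hdc'.clm_apply continuous_const
    deriv_x := fun s u => ?_
    mean_value := fun u s s' hss => ?_ }, fun _ _ => rfl⟩
  · have h1 : HasDerivWithinAt (fun u : ℝ => ((s : ℝ), u)) ((0 : ℝ), (1 : ℝ)) univ u :=
      ((hasDerivAt_const u (s : ℝ)).prodMk (hasDerivAt_id u)).hasDerivWithinAt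
    exact hasDerivWithinAt_univ.1
      ((hd _ (hmem s u)).comp_hasDerivWithinAt u h1 fun u' _ => hmem s u')
  · rcases hss.eq_or_lt with rfl | hlt
    · exact ⟨s, ⟨le_rfl, le_rfl⟩, by simp⟩
    · have hsub : ∀ r ∈ Icc (s : ℝ) s', r ∈ Icc (0 : ℝ) T := fun r hr =>
        ⟨s.2.1.trans hr.1, hr.2.trans s'.2.2⟩
      obtain ⟨r, hr, hr'⟩ := exists_hasDerivAt_eq_slope (fun r => φ r u)
        (fun r => fderivWithin ℝ g S (r, u) (1, 0)) (Subtype.coe_lt_coe.2 hlt)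
        (fun r hr => ((hdt r u (hsub r hr)).mono hsub).continuousWithinAt)
        (fun r hr => (hdt r u (hsub r (Ioo_subset_Icc_self hr))).hasDerivAt
          (Icc_mem_nhds (s.2.1.trans_lt hr.1) (hr.2.trans_le s'.2.2)))
      refine ⟨⟨r, hsub r (Ioo_subset_Icc_self hr)⟩, ⟨hr.1.le, hr.2.le⟩, ?_⟩
      have hne : ((s' : ℝ) - s) ≠ 0 := sub_ne_zero.2 (Subtype.coe_lt_coe.2 hlt).ne'
      simp only at hr' ⊢
      rw [hr', div_mul_cancel₀ _ hne]

/-! ### The stock position and its gain -/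

section Portfolio

variable {J : Set (RCLL T)} {τ : ℕ → J → Time T}

theorem IsFiniteStoppingSeq.monotone (hτ : IsFiniteStoppingSeq τ) (x : J) :
    Monotone fun i => τ i x := monotone_nat_of_le_succ (hτ.mono x)

theorem IsFiniteStoppingSeq.eq_top (hτ : IsFiniteStoppingSeq τ) (x : J) {i : ℕ}
    (hi : stopIndex τ x ≤ i) : τ i x = ⊤ := by
  have h : τ (stopIndex τ x) x = ⊤ := Nat.sInf_mem (s := {i | τ i x = ⊤}) (hτ.reaches x)
  exact top_le_iff.1 (h ▸ hτ.monotone x hi)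

/-- If `σ x < t`, the paths agree on `[0, σ x]`, which forces equal stopping times. -/
theorem IsNPStoppingTime.lt_iff {T : ℝ} {J : Set (RCLL T)} {σ : J → Time T}
    (hσ : IsNPStoppingTime σ) {t : Time T} {x x' : J} (h : ∀ s < t, x.1 s = x'.1 s) : σ x < t ↔ σ x' < t := by
  constructor
  · intro hx
    rwa [hσ x x' fun s hs => h s (hs.trans_lt hx)]
  · intro hx
    rwa [hσ x' x fun s hs => (h s (hs.trans_lt hx)).symm]

/-- Terms past `stopIndex` live on empty intervals, as both ends are `⊤`. A common range is needed
to compare paths that agree only before `t` and may have different stop indices. -/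
theorem stockPosition_eq_sum (hτ : IsFiniteStoppingSeq τ) (φ : ℕ → ℝ → ℝ → ℝ) (t : Time T) (x : J)
    {N : ℕ} (hN : stopIndex τ x ≤ N) :
    stockPosition τ φ t x =
      (Icc (τ 0 x) (τ 1 x)).indicator (fun s : Time T => φ 0 s (leftVal x.1 s)) t +
      ∑ i ∈ Finset.Icc 1 N,
        (Ioc (τ i x) (τ (i + 1) x)).indicator (fun s : Time T => φ i s (leftVal x.1 s)) t := by
  rw [stockPosition]
  congr 1
  refine Finset.sum_subset (Finset.Icc_subset_Icc_right (by omega)) fun i hi hi' => ?_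
  rw [Finset.mem_Icc] at hi hi'
  rw [hτ.eq_top x (i := i) (by omega)]
  simp

theorem stockPosition_bot (hτ : IsFiniteStoppingSeq τ) (φ : ℕ → ℝ → ℝ → ℝ) (x : J) :
    stockPosition τ φ ⊥ x = φ 0 0 (x.1 ⊥) := by
  rw [stockPosition, hτ.zero, indicator_of_mem (by simp), Finset.sum_eq_zero, add_zero,
    leftVal_bot]
  · rfl
  · intro i _
    simp

/-- The stock position at time `t` depends only on the path before `t`. -/
theorem stockPosition_congr (hτ : IsFiniteStoppingSeq τ) (φ : ℕ → ℝ → ℝ → ℝ) {t : Time T}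
    {x x' : J} (hbot : x.1 ⊥ = x'.1 ⊥) (h : ∀ s < t, x.1 s = x'.1 s) :
    stockPosition τ φ t x = stockPosition τ φ t x' := by
  rcases eq_or_ne t ⊥ with rfl | ht
  · rw [stockPosition_bot hτ, stockPosition_bot hτ, hbot]
  · have hl : leftVal x.1.toFun t = leftVal x'.1.toFun t := leftVal_congr ht (x.1.left_lim t) h
    have hlt := fun i => (hτ.stopping i).lt_iff h
    have hle : ∀ i, t ≤ τ i x ↔ t ≤ τ i x' := fun i => by
      rw [← not_lt, ← not_lt, hlt i]
    rw [stockPosition_eq_sum hτ φ t x (le_max_left _ (stopIndex τ x')),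
      stockPosition_eq_sum hτ φ t x' (le_max_right (stopIndex τ x) _)]
    simp only [indicator, mem_Icc, mem_Ioc, hlt, hle, hl, hτ.zero, bot_le, true_and]

theorem isCaglad_stockPosition (hτ : IsFiniteStoppingSeq τ) {φ : ℕ → ℝ → ℝ → ℝ}
    {f : ℕ → SmoothIntegrand T} (hf : ∀ i (s : Time T) u, (f i).f s u = φ i s u) (x : J) :
    IsCaglad fun t => stockPosition τ φ t x := by
  have h : ∀ i, IsCaglad fun s : Time T => φ i s (leftVal x.1 s) := fun i => by
    simp_rw [← hf]
    exact x.1.isCadlag.isCaglad_leftVal.comp (f i).cont_f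
  simp only [stockPosition, hτ.zero]
  exact ((h 0).indicator_Icc_bot _).add (IsCaglad.sum _ fun i => (h i).indicator_Ioc _ _)

/-- The Itô formula for the gain of the stock position up to time `t`. -/
def itoGain (τ : ℕ → J → Time T) (f : ℕ → SmoothIntegrand T) (σ : ℝ) (x : J) (t : Time T) : ℝ :=
  (f 0).itoValue σ x.1 (min (τ 1 x) t) + ∑ i ∈ Finset.Icc 1 (stopIndex τ x - 1),
    ((f i).itoValue σ x.1 (min (τ (i + 1) x) t) - (f i).itoValue σ x.1 (min (τ i x) t))

theorem hasFollmerIntegral_stockPosition {𝒯 : PartitionSeq T} (hτ : IsFiniteStoppingSeq τ)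
    {φ : ℕ → ℝ → ℝ → ℝ} {f : ℕ → SmoothIntegrand T}
    (hf : ∀ i (s : Time T) u, (f i).f s u = φ i s u) {σ : ℝ} {x : J}
    (hx : ∀ (f : SmoothIntegrand T) t,
      HasFollmerIntegral 𝒯 (fun s => f.f s (leftVal x.1 s)) x.1 t (f.itoValue σ x.1 t))
    (t : Time T) :
    HasFollmerIntegral 𝒯 (fun s => stockPosition τ φ s x) x.1 t (itoGain τ f σ x t) := by
  simp only [stockPosition, hτ.zero, ← hf]
  refine HasFollmerIntegral.add ?_ (HasFollmerIntegral.sum _ fun i _ => ?_)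
  · obtain ⟨B, hB⟩ := x.1.isCadlag.comp_leftVal_bound (f 0).cont_f
    exact HasFollmerIntegral.indicator_Icc_bot x.1.right_cont hB (hx (f 0)) _ t
  · obtain ⟨B, hB⟩ := x.1.isCadlag.comp_leftVal_bound (f i).cont_f
    exact HasFollmerIntegral.indicator_Ioc x.1.right_cont hB (hx (f i)) (hτ.mono x i) t

theorem continuousWithinAt_comp_min {T : ℝ} {I : Time T → ℝ} (hI : ∀ t, ContinuousWithinAt I (Ici t) t)
    (a t : Time T) : ContinuousWithinAt (fun s => I (min a s)) (Ici t) t := by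
  rcases lt_or_ge t a with h | h
  · refine (hI t).congr_of_eventuallyEq ?_ (by rw [min_eq_right h.le])
    filter_upwards [nhdsWithin_le_nhds (Iio_mem_nhds h)] with s hs
    rw [min_eq_right (le_of_lt hs)]
  · refine (continuousWithinAt_const (b := I a)).congr (fun s hs => ?_) (by rw [min_eq_left h])
    rw [min_eq_left (h.trans hs)]

theorem tendsto_comp_min {T : ℝ} {I : Time T → ℝ} {t : Time T} {d : ℝ}
    (hI : Tendsto I (𝓝[<] t) (𝓝 (I t - d))) (a : Time T) :
    Tendsto (fun s => I (min a s)) (𝓝[<] t) (𝓝 (I (min a t) - if t ≤ a then d else 0)) := by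
  rcases le_or_gt t a with h | h
  · rw [if_pos h, min_eq_right h]
    refine hI.congr' ?_
    filter_upwards [self_mem_nhdsWithin] with s hs
    rw [min_eq_right (le_of_lt (lt_of_lt_of_le hs h))]
  · rw [if_neg (not_le.2 h), min_eq_left h.le, sub_zero]
    refine tendsto_const_nhds.congr' ?_
    filter_upwards [nhdsWithin_le_nhds (Ioi_mem_nhds h)] with s hs
    rw [min_eq_left (le_of_lt hs)]

theorem itoGain_rightCont (f : ℕ → SmoothIntegrand T) (σ : ℝ) {x : J} {E : Finset (Time T)}
    (hE : ∀ t, leftVal x.1.toFun t ≠ x.1 t → t ∈ E) (t : Time T) :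
    ContinuousWithinAt (itoGain τ f σ x) (Ici t) t := by
  have h := fun i => (f i).itoValue_rightCont σ x.1.isCadlag hE
  exact (continuousWithinAt_comp_min (h 0) _ t).add (tendsto_finsetSum _ fun i _ =>
    (continuousWithinAt_comp_min (h i) _ t).sub (continuousWithinAt_comp_min (h i) _ t))

/-- The gain jumps by the stock position times the jump of the path. -/
theorem itoGain_leftLim (hτ : IsFiniteStoppingSeq τ) {φ : ℕ → ℝ → ℝ → ℝ}
    {f : ℕ → SmoothIntegrand T} (hf : ∀ i (s : Time T) u, (f i).f s u = φ i s u) (σ : ℝ) {x : J}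
    {E : Finset (Time T)} (hE : ∀ t, leftVal x.1.toFun t ≠ x.1 t → t ∈ E) (t : Time T) :
    Tendsto (itoGain τ f σ x) (𝓝[<] t) (𝓝 (itoGain τ f σ x t -
      stockPosition τ φ t x * (x.1 t - leftVal x.1.toFun t))) := by
  have h := fun i a => tendsto_comp_min ((f i).itoValue_leftLim σ x.1.isCadlag hE t) a
  have key := (h 0 (τ 1 x)).add (tendsto_finsetSum (Finset.Icc 1 (stopIndex τ x - 1)) fun i _ =>
    (h i (τ (i + 1) x)).sub (h i (τ i x)))
  refine key.mono_right (le_of_eq (congrArg 𝓝 (Eq.symm ?_)))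
  -- The jump is split term by term: stopping at `τ_i` keeps the jump at `t` when `t ≤ τ_i`, and the
  -- difference of consecutive such conditions is the indicator of `(τ_i, τ_{i+1}]`.
  rw [itoGain, stockPosition, add_mul, Finset.sum_mul, add_sub_add_comm, ← Finset.sum_sub_distrib]
  congr 1
  · simp only [indicator, hτ.zero, mem_Icc, bot_le, true_and, hf]
    split_ifs <;> ring
  · refine Finset.sum_congr rfl fun i _ => ?_
    have hmono := hτ.mono x i
    simp only [indicator, mem_Ioc, hf]
    rcases le_or_gt t (τ i x) with h1 | h1
    · rw [if_neg (fun h' => absurd h'.1 (not_lt.2 h1)), if_pos h1, if_pos (h1.trans hmono)]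
      ring
    · rw [if_neg (not_le.2 h1)]
      by_cases h2 : t ≤ τ (i + 1) x
      · rw [if_pos ⟨h1, h2⟩, if_pos h2]; ring
      · rw [if_neg (fun h' => h2 h'.2), if_neg h2]; ring

/-- Since `ℕ` is discrete, the stop index is eventually constant, so the number of terms is fixed;
at time `⊤` only values at the stopping times remain. -/
theorem tendsto_itoGain (f : ℕ → SmoothIntegrand T) (σ : ℝ) {u : ℕ → J} {x : J}
    (hI : ∀ i j, Tendsto (fun n => (f i).itoValue σ (u n).1.toFun (τ j (u n))) atTop
      (𝓝 ((f i).itoValue σ x.1.toFun (τ j x))))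
    (hM : Tendsto (fun n => stopIndex τ (u n)) atTop (𝓝 (stopIndex τ x))) :
    Tendsto (fun n => itoGain τ f σ (u n) ⊤) atTop (𝓝 (itoGain τ f σ x ⊤)) := by
  simp only [itoGain, min_top_right]
  have h := (hI 0 1).add (tendsto_finsetSum (Finset.Icc 1 (stopIndex τ x - 1)) fun i _ =>
    (hI i (i + 1)).sub (hI i i))
  refine h.congr' ?_
  rw [nhds_discrete, tendsto_pure] at hM
  filter_upwards [hM] with n hn
  rw [hn]

end Portfolio

/-! ### The jump-diffusion class -/

section JumpDiffusion

variable {𝒯 : PartitionSeq T} {x₀ σ : ℝ} {C : Set ℝ}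

theorem jumpDiffusion_apply_bot {x : RCLL T} (hx : x ∈ jumpDiffusion 𝒯 x₀ σ C) : x ⊥ = x₀ := by
  obtain ⟨z, hz, r, c, h⟩ := exists_jumpPath_of_mem hx
  rw [h.apply_bot, hz.2.1]
  simp

theorem continuous_of_diffusionPath {z : Time T → ℝ} (hz : z ∈ diffusionPaths 𝒯) :
    Continuous fun t => x₀ * Real.exp (σ * z t) := by
  have := hz.1
  fun_prop

theorem jumpDiffusion_exists_finset {x : RCLL T} (hx : x ∈ jumpDiffusion 𝒯 x₀ σ C) :
    ∃ E : Finset (Time T), ∀ t, leftVal x.toFun t ≠ x t → t ∈ E := by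
  obtain ⟨z, hz, r, c, h⟩ := exists_jumpPath_of_mem hx
  exact h.exists_finset (continuous_of_diffusionPath hz)

theorem jumpDiffusion_hasFollmerIntegral {x : RCLL T} (hx : x ∈ jumpDiffusion 𝒯 x₀ σ C)
    (f : SmoothIntegrand T) (t : Time T) :
    HasFollmerIntegral 𝒯 (fun s => f.f s (leftVal x.toFun s)) x.toFun t
      (f.itoValue σ x.toFun t) := by
  obtain ⟨z, hz, r, c, h⟩ := exists_jumpPath_of_mem hx
  exact h.hasFollmerIntegral hz f t

/-- Compactness bounds `σ z` and hence the continuous factor from below; the finitely many factors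
`1 + a_i` are nonzero. -/
theorem jumpDiffusion_exists_pos_le_abs {x : RCLL T} (hx : x ∈ jumpDiffusion 𝒯 x₀ σ C)
    (hx₀ : x₀ ≠ 0) (hC : ∀ a ∈ C, 1 + a ≠ 0) : ∃ m > 0, ∀ t, m ≤ |x t| := by
  obtain ⟨z, hz, r, c, h⟩ := exists_jumpPath_of_mem hx
  obtain ⟨B, -, hB⟩ := (isRegulated_of_continuous (hz.1.const_mul σ)).exists_bound
  refine (h.exists_pos_le_abs (m := |x₀| * Real.exp (-B)) (by positivity) (fun t => ?_) hC).2
  rw [abs_mul, abs_of_pos (Real.exp_pos _)]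
  exact mul_le_mul_of_nonneg_left (Real.exp_le_exp.2 (abs_le.1 (hB t)).1) (abs_nonneg _)

theorem jumpDiffusion_jump_size {x : RCLL T} (hx : x ∈ jumpDiffusion 𝒯 x₀ σ C) {δ : ℝ}
    (hδ : ∀ a ∈ C, δ ≤ |a|) {t : Time T} (ht : leftVal x.toFun t ≠ x t) :
    δ * |leftVal x.toFun t| ≤ |x t - leftVal x.toFun t| := by
  obtain ⟨z, hz, r, c, h⟩ := exists_jumpPath_of_mem hx
  obtain ⟨a, ha, h'⟩ := h.exists_jump_size (continuous_of_diffusionPath hz) ht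
  rw [h', abs_mul]
  exact mul_le_mul_of_nonneg_right (hδ a ha) (abs_nonneg _)

/-- For `x₀ = 0` no positive lower bound exists, but every path vanishes and there are no jumps to
match. -/
theorem jumpDiffusion_zero {x : RCLL T} (hx : x ∈ jumpDiffusion 𝒯 0 σ C) (t : Time T) :
    leftVal x.toFun t = x t := by
  obtain ⟨z, -, m, s, a, -, -, -, h⟩ := hx
  have : x.toFun = fun _ => 0 := funext fun t => by rw [h t]; simp
  rw [this]
  exact leftVal_eq_of_continuousAt continuousAt_const

theorem jumpDiffusion_tendsto_itoValue (hC : ∀ a ∈ C, 1 + a ≠ 0) {δ : ℝ} (hδ : 0 < δ)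
    (hCδ : ∀ a ∈ C, δ ≤ |a|) {u : ℕ → jumpDiffusion 𝒯 x₀ σ C} {x : jumpDiffusion 𝒯 x₀ σ C}
    (hu : Tendsto u atTop (𝓝 x)) (f : SmoothIntegrand T) {ρ : ℕ → Time T} {ρ' : Time T}
    (hρ : Tendsto ρ atTop (𝓝 ρ')) (hxρ : Tendsto (fun n => (u n).1 (ρ n)) atTop (𝓝 (x.1 ρ'))) :
    Tendsto (fun n => f.itoValue σ (u n).1.toFun (ρ n)) atTop (𝓝 (f.itoValue σ x.1.toFun ρ')) := by
  obtain ⟨l, hl⟩ := exists_timeChange ((continuous_subtype_val.tendsto x).comp hu)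
  obtain ⟨E, hE⟩ := jumpDiffusion_exists_finset x.2
  refine f.tendsto_itoValue_of_tendsto σ (u := fun n => (u n).1) hl hE ?_ hρ hxρ
  by_cases hx₀ : x₀ = 0
  · subst hx₀
    exact Eventually.of_forall fun n t ht => absurd (jumpDiffusion_zero (u n).2 t) ht
  · obtain ⟨m, hm, hxm⟩ := jumpDiffusion_exists_pos_le_abs x.2 hx₀ hC
    filter_upwards [eventually_jump_of_jump (u := fun n => (u n).1) hl hm hδ hxm
      fun n t ht => jumpDiffusion_jump_size (u n).2 hCδ ht] with n hn t ht
    exact hE _ (hn t ht)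

end JumpDiffusion

end NPMarket

end

open NPMarket in
theorem mainTheorem3 {T : ℝ} [Fact (0 < T)] (𝒯 : PartitionSeq T)
    (x₀ σ : ℝ) (hσ : 0 < σ)
    (C : Set ℝ) (hC : C.Nonempty) (hC_bdd : BddBelow C) (hC_inf : -1 < sInf C)
    (hC_abs : 0 < sInf ((fun c : ℝ => |c|) '' C))
    (τ : ℕ → jumpDiffusion 𝒯 x₀ σ C → Time T)
    (hτ : IsFiniteStoppingSeq τ) (hτ_cont : JointlyStrongLocallyContinuous τ)
    (φ : ℕ → ℝ → ℝ → ℝ)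
    (hφ : ∀ i, ContDiffOn ℝ 1 (fun p : ℝ × ℝ => φ i p.1 p.2) (Set.Icc 0 T ×ˢ Set.univ))
    (V₀ : ℝ) :
    IsNPPortfolio (financedPortfolio 𝒯 V₀ (stockPosition τ φ)) ∧
    IsNPPredictable (financedPortfolio 𝒯 V₀ (stockPosition τ φ)) ∧
    IsNPSelfFinancing 𝒯 0 (financedPortfolio 𝒯 V₀ (stockPosition τ φ)) ∧
    IsLocallyVContinuous (financedPortfolio 𝒯 V₀ (stockPosition τ φ)) := by
  choose f hf using fun i => exists_smoothIntegrand (hφ i)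
  have hC1 : ∀ a ∈ C, 1 + a ≠ 0 := fun a ha => by
    have := csInf_le hC_bdd ha
    linarith
  have hC2 : ∀ a ∈ C, sInf ((fun c : ℝ => |c|) '' C) ≤ |a| := fun a ha =>
    csInf_le ⟨0, by rintro _ ⟨c, -, rfl⟩; exact abs_nonneg c⟩ ⟨a, ha, rfl⟩
  have hint : ∀ x t, HasFollmerIntegral 𝒯 (fun s => stockPosition τ φ s x) x.1 t
      (itoGain τ f σ x t) := fun x t =>
    hasFollmerIntegral_stockPosition hτ hf (jumpDiffusion_hasFollmerIntegral x.2) t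
  have hgain : ∀ x t, gain 𝒯 V₀ (stockPosition τ φ) t x = V₀ + itoGain τ f σ x t := fun x t => by
    rw [gain, follmerIntegral, (hint x t).limUnder_eq]
  have hzero : ∀ x, itoGain τ f σ x ⊥ = 0 := fun x =>
    tendsto_nhds_unique (hint x ⊥) (by simp [funext (follmerSum_bot 𝒯 _ _)])
  have hleft : ∀ x t, Tendsto (fun s => gain 𝒯 V₀ (stockPosition τ φ) s x) (𝓝[<] t)
      (𝓝 (gain 𝒯 V₀ (stockPosition τ φ) t x -
        stockPosition τ φ t x * (x.1 t - leftVal x.1.toFun t))) := fun x t => by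
    obtain ⟨E, hE⟩ := jumpDiffusion_exists_finset x.2
    simp only [hgain, add_sub_assoc]
    exact (itoGain_leftLim hτ hf σ hE t).const_add V₀
  have hcadlag : ∀ x, IsCadlag fun s => gain 𝒯 V₀ (stockPosition τ φ) s x := fun x t => by
    obtain ⟨E, hE⟩ := jumpDiffusion_exists_finset x.2
    refine ⟨?_, _, hleft x t⟩
    simp only [hgain]
    exact continuousWithinAt_const.add (itoGain_rightCont f σ hE t)
  have hleftVal : ∀ x t, leftVal (fun s => gain 𝒯 V₀ (stockPosition τ φ) s x) t =
      gain 𝒯 V₀ (stockPosition τ φ) t x -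
        stockPosition τ φ t x * (x.1 t - leftVal x.1.toFun t) := fun x t => by
    rcases eq_or_ne t ⊥ with rfl | ht
    · rw [leftVal_bot, leftVal_bot, sub_self, mul_zero, sub_zero]
    · exact leftVal_eq_of_tendsto ht (hleft x t)
  have hbot : ∀ x x' : jumpDiffusion 𝒯 x₀ σ C, x.1 ⊥ = x'.1 ⊥ := fun x x' => by
    rw [jumpDiffusion_apply_bot x.2, jumpDiffusion_apply_bot x'.2]
  -- The left limit of the gain plus `φ Δx` restores the gain.
  have hvalue : ∀ x t, value (financedPortfolio 𝒯 V₀ (stockPosition τ φ)) t x =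
      V₀ + itoGain τ f σ x t := fun x t => by
    rw [value, financedPortfolio, hleftVal, hgain]
    ring
  have hcaglad : ∀ x, IsCaglad fun t => stockPosition τ φ t x := isCaglad_stockPosition hτ hf
  have hpsi : ∀ x, IsCaglad fun t => (financedPortfolio 𝒯 V₀ (stockPosition τ φ) t x).1 := fun x =>
    (hcadlag x).isCaglad_leftVal.sub (x.1.isCadlag.isCaglad_leftVal.mul (hcaglad x))
  have hadapted : ∀ (t : Time T) (x x' : jumpDiffusion 𝒯 x₀ σ C), (∀ s < t, x.1 s = x'.1 s) →
      financedPortfolio 𝒯 V₀ (stockPosition τ φ) t x =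
        financedPortfolio 𝒯 V₀ (stockPosition τ φ) t x' := by
    intro t x x' h
    have hpos := stockPosition_congr hτ φ (hbot x x') h
    rw [financedPortfolio, financedPortfolio, hpos]
    rcases eq_or_ne t ⊥ with rfl | ht
    · simp only [leftVal_bot, hgain, hzero, hbot x x']
    -- For `s < t` the Föllmer sums of the two paths are equal for every `n`, hence so are the gains
    -- at `s` and their left limits at `t`.
    · rw [leftVal_congr ht (x.1.left_lim t) h, leftVal_congr ht ⟨_, hleft x t⟩ fun s hs => ?_]
      have : follmerSum 𝒯 (fun u => stockPosition τ φ u x) x.1 s =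
          follmerSum 𝒯 (fun u => stockPosition τ φ u x') x'.1 s := funext fun n =>
        follmerSum_congr (fun u hu => stockPosition_congr hτ φ (hbot x x') fun r hr =>
          h r (hr.trans (hu.trans hs))) (fun u hu => h u (hu.trans_lt hs)) n
      rw [gain, gain, follmerIntegral, follmerIntegral, this]
  refine ⟨fun x x' => hadapted ⊥ x x' fun s hs => absurd hs not_lt_bot, ⟨hadapted, fun x t => ?_⟩,
    fun x t => ?_, fun x => ?_⟩
  · obtain ⟨l₁, h₁⟩ := (hpsi x t).2
    obtain ⟨l₂, h₂⟩ := (hcaglad x t).2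
    exact ⟨(hpsi x t).1.prodMk (hcaglad x t).1, (l₁, l₂), h₁.prodMk_nhds h₂⟩
  -- With interest rate `0` only the existence of the Riemann integral matters.
  · refine ⟨_, _, (hpsi x).isRegulated.hasRiemannIntegral t, hint x t, ?_⟩
    rw [hvalue, hvalue, hzero]
    ring
  · obtain ⟨U, hU, hxU, h⟩ := hτ_cont x
    refine ⟨U, hU, hxU, fun u hu hux => ?_⟩
    obtain ⟨h₁, h₂, h₃⟩ := h u hu hux
    simp only [hvalue]
    exact (tendsto_itoGain f σ (fun i j => jumpDiffusion_tendsto_itoValue hC1 hC_abs hC2 hux (f i)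
      (h₁ j) (h₂ j)) h₃).const_add V₀
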